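/- Let $\widetilde{Rat_3}$ be the moduli space of charge three lumps on $\mathbb{R}P^2$: the set of rational maps $R:\mathbb{C}\cup\{\infty\}\to\mathbb{C}\cup\{\infty\}$ of degree $3$ with $R(-1/\bar z)=-1/\overline{R(z)}$ for all $z$. These are exactly the maps $R_a(z)=\sum_{k=0}^3a_kz^k\big/\sum_{k=0}^3(-1)^k\bar a_{3-k}z^k$, where $a\in\mathbb{C}^4$ is such that numerator and denominator have no common root; $a$ is unique up to a nonzero real factor, so $\widetilde{Rat_3}$ is an open subset of $\mathbb{R}P^7$, a $7$-dimensional manifold. Its $L^2$ metric $g$ is given in local coordinates $y$ by $$g_{kl}=\int_{\mathbb{C}}\frac{\Re\big(\partial_{y_k}R\;\overline{\partial_{y_l}R}\big)}{(1+|R|^2)^2}\,\frac{dA}{(1+|z|^2)^2},\qquad dA=dx\,dy .$$ (1) These integrals converge. (2) For $c\ge 0$, $c\ne1$, let $R_c(z)=\frac{z^3+cz}{cz^2+1}$. On the orbits $z\mapsto M(R_c(Uz))$, $U,M\in SU(2)$ acting by Möbius transformations, the $L^2$ metric is $$g=C(c)\,dc^2+\sum_{i=1}^3\big(A_{ii}(c)\,\sigma_i^2+D_{ii}(c)\,\eta_i^2+F_{ii}(c)\,\sigma_i\eta_i\big),$$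 where $dU\,U^{-1}=\sum_i\sigma_i\,\tfrac{i}{2}\tau_i$ and $M^{-1}dM=\sum_i\eta_i\,\tfrac{i}{2}\tau_i$ with the Pauli matrices $\tau_i$, and, with $d\nu=\frac{1}{(1+|R_c|^2)^2}\frac{dA}{(1+|z|^2)^2}$ and $v_1(z)=\tfrac i2(1-z^2)$, $v_2(z)=\tfrac12(1+z^2)$, $v_3(z)=iz$, $$C=\int_{\mathbb{C}}|\partial_cR_c|^2d\nu,\quad A_{ii}=\int_{\mathbb{C}}|v_i(z)R_c'(z)|^2d\nu,\quad D_{ii}=\int_{\mathbb{C}}|v_i(R_c)|^2d\nu,\quad F_{ii}=2\int_{\mathbb{C}}\Re\big(v_i(z)R_c'(z)\overline{v_i(R_c)}\big)d\nu .$$ (3) The Riemannian volume of $(\widetilde{Rat_3},g)$ is finite. -/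

import Mathlib

open MeasureTheory Polynomial
open scoped OnePoint ComplexConjugate

noncomputable section

namespace Lump

/-! ### Rational maps of the Riemann sphere -/

/-- The antipodal map `z ↦ -1 / conj z` of the Riemann sphere. -/
def antipode : OnePoint ℂ → OnePoint ℂ
  | none => ((0 : ℂ) : OnePoint ℂ)
  | some z => if z = 0 then ∞ else ((-1 / conj z : ℂ) : OnePoint ℂ)

/-- The self-map `p / q` of the Riemann sphere, for polynomials `p`, `q` without common root. -/
def ratMap (p q : ℂ[X]) : OnePoint ℂ → OnePoint ℂ
  | none =>
      if q.coeff (max p.natDegree q.natDegree) = 0 then ∞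
      else ((p.coeff (max p.natDegree q.natDegree) /
        q.coeff (max p.natDegree q.natDegree) : ℂ) : OnePoint ℂ)
  | some z => if q.eval z = 0 then ∞ else ((p.eval z / q.eval z : ℂ) : OnePoint ℂ)

/-- The set of rational maps of degree `N` of the Riemann sphere. -/
def Rat (N : ℕ) : Set (OnePoint ℂ → OnePoint ℂ) :=
  {R | ∃ p q : ℂ[X], IsCoprime p q ∧ max p.natDegree q.natDegree = N ∧ R = ratMap p q}

/-- The moduli space of charge `N` lumps on the real projective plane: the rational maps of
degree `N` that commute with the antipodal map. -/
def RatTilde (N : ℕ) : Set (OnePoint ℂ → OnePoint ℂ) :=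
  {R | R ∈ Rat N ∧ ∀ z, R (antipode z) = antipode (R z)}

/-! ### The `L²` metric -/

/-- A map of the sphere in the affine coordinate `z` (with value `0` at its poles). -/
def affine (R : OnePoint ℂ → OnePoint ℂ) (z : ℂ) : ℂ :=
  (R (z : OnePoint ℂ)).elim 0 id

/-- The integrand of the `L²` inner product of two infinitesimal deformations `u`, `v` of the
map `R`, written in the affine coordinate. -/
def l2Density (R : OnePoint ℂ → OnePoint ℂ) (u v : ℂ → ℂ) (z : ℂ) : ℝ :=
  (u z * conj (v z)).re / ((1 + ‖affine R z‖ ^ 2) ^ 2 * (1 + ‖z‖ ^ 2) ^ 2)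

/-- The `L²` inner product of two infinitesimal deformations `u`, `v` of the map `R`. -/
def l2Inner (R : OnePoint ℂ → OnePoint ℂ) (u v : ℂ → ℂ) : ℝ :=
  ∫ z : ℂ, l2Density R u v z

/-- The infinitesimal deformation `∂Φ/∂y_k` of a family of maps with parameters `y ∈ ℝⁿ`. -/
def partialField {n : ℕ} (Φ : (Fin n → ℝ) → OnePoint ℂ → OnePoint ℂ) (y : Fin n → ℝ)
    (k : Fin n) (z : ℂ) : ℂ :=
  lineDeriv ℝ (fun y' => affine (Φ y') z) y (Pi.single k 1)

/-- The matrix of the `L²` metric in the coordinates of a family of maps. -/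
def l2Gram {n : ℕ} (Φ : (Fin n → ℝ) → OnePoint ℂ → OnePoint ℂ) (y : Fin n → ℝ) :
    Matrix (Fin n) (Fin n) ℝ :=
  Matrix.of fun k l => l2Inner (Φ y) (partialField Φ y k) (partialField Φ y l)

/-- The Riemannian volume, for the `L²` metric, of a manifold of maps with a finite atlas of
coordinate systems `chart j : dom j → M`. The part of the manifold that lies in the `j`-th
coordinate patch and in no earlier one contributes the integral of `√|det g|` in the `j`-th
coordinates. -/
def atlasVolume {m n : ℕ} (dom : Fin m → Set (Fin n → ℝ))
    (chart : Fin m → (Fin n → ℝ) → OnePoint ℂ → OnePoint ℂ) : ENNReal :=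
  ∑ j, ∫⁻ y in {y | y ∈ dom j ∧ ∀ i < j, chart j y ∉ chart i '' dom i},
    ENNReal.ofReal (Real.sqrt |(l2Gram (chart j) y).det|)

/-! ### The atlas of the moduli space of charge three lumps

The maps that commute with the antipodal map are `∑ a_k z^k / ∑ (-1)^k conj(a_{3-k}) z^k` with
`a ∈ ℂ⁴ = ℝ⁸`, and `a` is unique up to a nonzero real factor. So the moduli space is an open subset
of the real projective space of dimension 7; its coordinate systems are the eight affine
ones. Each is restricted to a cube; a representative with largest coordinate `1` shows that the
restricted ones still cover the moduli space (`iUnion_lumpChart`). -/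

/-- The point of `ℂ⁴` with real parts `x₀, …, x₃` and imaginary parts `x₄, …, x₇`. -/
def coeffs (x : Fin 8 → ℝ) (k : Fin 4) : ℂ :=
  ⟨x (Fin.castAdd 4 k), x (Fin.natAdd 4 k)⟩

/-- The numerator `∑ a_k z^k`. -/
def num (a : Fin 4 → ℂ) : ℂ[X] := ∑ k : Fin 4, C (a k) * X ^ (k : ℕ)

/-- The denominator `∑ (-1)^k conj(a_{3-k}) z^k`. -/
def den (a : Fin 4 → ℂ) : ℂ[X] := ∑ k : Fin 4, C ((-1) ^ (k : ℕ) * conj (a k.rev)) * X ^ (k : ℕ)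

/-- The coefficient vector whose `j`-th real coordinate is `1`, and whose other coordinates
are `y`. -/
def lumpCoeffs (j : Fin 8) (y : Fin 7 → ℝ) : Fin 4 → ℂ :=
  coeffs (j.insertNth (α := fun _ => ℝ) 1 y)

/-- The `j`-th affine parametrization of the moduli space. -/
def lumpChart (j : Fin 8) (y : Fin 7 → ℝ) : OnePoint ℂ → OnePoint ℂ :=
  ratMap (num (lumpCoeffs j y)) (den (lumpCoeffs j y))

/-- The domain of the `j`-th parametrization. -/
def lumpDom (j : Fin 8) : Set (Fin 7 → ℝ) :=
  {y | (∀ k, |y k| < 2) ∧ IsCoprime (num (lumpCoeffs j y)) (den (lumpCoeffs j y))}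

lemma antipode_coe (z : ℂ) : antipode (z : OnePoint ℂ) =
    if z = 0 then ∞ else ((-1 / conj z : ℂ) : OnePoint ℂ) := rfl

lemma antipode_infty : antipode ∞ = ((0 : ℂ) : OnePoint ℂ) := rfl

lemma ratMap_coe (p q : ℂ[X]) (z : ℂ) : ratMap p q (z : OnePoint ℂ) =
    if q.eval z = 0 then ∞ else ((p.eval z / q.eval z : ℂ) : OnePoint ℂ) := rfl

lemma ratMap_infty (p q : ℂ[X]) {n : ℕ} (h : max p.natDegree q.natDegree = n) : ratMap p q ∞ =
    if q.coeff n = 0 then ∞ else ((p.coeff n / q.coeff n : ℂ) : OnePoint ℂ) := by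
  subst h; rfl

lemma ratMap_C_mul (p q : ℂ[X]) {r : ℂ} (hr : r ≠ 0) :
    ratMap (C r * p) (C r * q) = ratMap p q := by
  funext z
  induction z using OnePoint.rec with
  | infty =>
    rw [ratMap_infty (C r * p) (C r * q) (n := max p.natDegree q.natDegree)
      (by rw [natDegree_C_mul hr, natDegree_C_mul hr]), ratMap_infty p q rfl]
    simp [hr, mul_div_mul_left]
  | coe z => simp [ratMap_coe, hr, mul_div_mul_left]

lemma num_eval (a : Fin 4 → ℂ) (z : ℂ) :
    (num a).eval z = a 0 + a 1 * z + a 2 * z ^ 2 + a 3 * z ^ 3 := by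
  simp [num, Fin.sum_univ_four]

lemma den_eq (a : Fin 4 → ℂ) :
    den a = num ![conj (a 3), -conj (a 2), conj (a 1), -conj (a 0)] := by
  simp [den, num, Fin.sum_univ_four, show Fin.rev (0 : Fin 4) = 3 from rfl,
    show Fin.rev (1 : Fin 4) = 2 from rfl, show Fin.rev (2 : Fin 4) = 1 from rfl,
    show Fin.rev (3 : Fin 4) = 0 from rfl, pow_succ]

lemma den_eval (a : Fin 4 → ℂ) (z : ℂ) : (den a).eval z =
    conj (a 3) - conj (a 2) * z + conj (a 1) * z ^ 2 - conj (a 0) * z ^ 3 := by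
  rw [den_eq, num_eval]; simp; ring

lemma num_coeff (a : Fin 4 → ℂ) (k : Fin 4) : (num a).coeff k = a k := by
  fin_cases k <;> simp [num, Fin.sum_univ_four, coeff_X, coeff_C, coeff_X_pow]

lemma num_natDegree (a : Fin 4 → ℂ) : (num a).natDegree ≤ 3 := by
  refine natDegree_sum_le_of_forall_le _ _ fun k _ => ?_
  exact (natDegree_C_mul_X_pow_le _ _).trans (by omega)

lemma eq_num {p : ℂ[X]} (hp : p.natDegree ≤ 3) : p = num fun k => p.coeff k := by
  ext n
  by_cases hn : n < 4
  · exact (num_coeff (fun k : Fin 4 => p.coeff k) ⟨n, hn⟩).symm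
  · rw [coeff_eq_zero_of_natDegree_lt (by omega),
      coeff_eq_zero_of_natDegree_lt ((num_natDegree _).trans_lt (by omega))]

lemma num_smul (r : ℂ) (a : Fin 4 → ℂ) : num (fun k => r * a k) = C r * num a := by
  simp [num, Finset.mul_sum, mul_assoc]

lemma den_smul (r : ℂ) (a : Fin 4 → ℂ) : den (fun k => r * a k) = C (conj r) * den a := by
  simp only [den, Finset.mul_sum]
  refine Finset.sum_congr rfl fun k _ => ?_
  simp only [map_mul]; ring

lemma num_antipode (a : Fin 4 → ℂ) {z : ℂ} (hz : z ≠ 0) :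
    (num a).eval (-1 / conj z) = conj (-(den a).eval z / z ^ 3) := by
  have : conj z ≠ 0 := by simpa using hz
  rw [num_eval, den_eval]; simp only [map_div₀, map_neg, map_sub, map_add, map_mul, map_pow,
    Complex.conj_conj]; field_simp; ring

lemma den_antipode (a : Fin 4 → ℂ) {z : ℂ} (hz : z ≠ 0) :
    (den a).eval (-1 / conj z) = conj ((num a).eval z / z ^ 3) := by
  have : conj z ≠ 0 := by simpa using hz
  rw [num_eval, den_eval]; simp only [map_div₀, map_add, map_mul, map_pow]; field_simp; ring

lemma isCoprime_iff (p q : ℂ[X]) :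
    IsCoprime p q ↔ ∀ z : ℂ, ¬ (p.eval z = 0 ∧ q.eval z = 0) := by
  rw [Polynomial.isCoprime_iff_aeval_ne_zero_of_isAlgClosed ℂ ℂ]
  simp only [aeval_def, Algebra.algebraMap_self, eval₂_id, ne_eq, not_and_or]

lemma max_natDegree {a : Fin 4 → ℂ} (h : IsCoprime (num a) (den a)) :
    max (num a).natDegree (den a).natDegree = 3 := by
  have h0 := (isCoprime_iff _ _).1 h 0
  rw [num_eval, den_eval] at h0
  simp only [mul_zero, add_zero, ne_eq, OfNat.ofNat_ne_zero, not_false_eq_true, zero_pow, sub_zero,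
    map_eq_zero] at h0
  have h1 := num_natDegree a
  have h2 : (den a).natDegree ≤ 3 := by rw [den_eq]; exact num_natDegree _
  apply le_antisymm (max_le h1 h2)
  by_cases h3 : a 3 = 0
  · refine le_max_of_le_right (le_natDegree_of_ne_zero ?_)
    rw [den_eq]
    refine (num_coeff _ 3).trans_ne ?_
    simpa using fun h => h0 ⟨h, h3⟩
  · refine le_max_of_le_left (le_natDegree_of_ne_zero ?_)
    exact (num_coeff _ 3).trans_ne h3

lemma ratMap_mem {a : Fin 4 → ℂ} (h : IsCoprime (num a) (den a)) :
    ratMap (num a) (den a) ∈ RatTilde 3 := by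
  refine ⟨⟨_, _, h, max_natDegree h, rfl⟩, fun z => ?_⟩
  have hc := (isCoprime_iff _ _).1 h
  have hn3 : (num a).coeff 3 = a 3 := num_coeff a 3
  have hd3 : (den a).coeff 3 = -conj (a 0) := by
    rw [den_eq]; exact num_coeff _ 3
  induction z using OnePoint.rec with
  | infty =>
    have h0 := hc 0
    rw [antipode_infty, ratMap_coe, ratMap_infty _ _ (max_natDegree h), hn3, hd3]
    rw [num_eval, den_eval] at *
    simp only [mul_zero, add_zero, ne_eq, OfNat.ofNat_ne_zero, not_false_eq_true, zero_pow, sub_zero,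
      map_eq_zero, neg_eq_zero] at *
    by_cases h3 : a 3 = 0
    · have h00 : a 0 ≠ 0 := fun h => h0 ⟨h, h3⟩
      simp [h3, h00, antipode_coe]
    · by_cases h00 : a 0 = 0
      · simp [h3, h00, antipode_infty]
      · have : conj (a 0) ≠ 0 := by simpa using h00
        have : conj (a 3) ≠ 0 := by simpa using h3
        simp [h3, h00, antipode_coe]
        field_simp
  | coe z =>
    by_cases hz : z = 0
    · subst hz
      have h0 := hc 0
      rw [antipode_coe, if_pos rfl, ratMap_coe, ratMap_infty _ _ (max_natDegree h), hn3, hd3]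
      rw [num_eval, den_eval] at *
      simp only [mul_zero, add_zero, ne_eq, OfNat.ofNat_ne_zero, not_false_eq_true, zero_pow,
        sub_zero, map_eq_zero, neg_eq_zero] at *
      by_cases h3 : a 3 = 0
      · have h00 : a 0 ≠ 0 := fun h => h0 ⟨h, h3⟩
        simp [h3, h00, antipode_infty]
      · by_cases h00 : a 0 = 0
        · simp [h3, h00, antipode_coe]
        · have : conj (a 0) ≠ 0 := by simpa using h00
          have : conj (a 3) ≠ 0 := by simpa using h3
          simp [h3, h00, antipode_coe]
          field_simp
    · have h0 := hc z
      rw [antipode_coe, if_neg hz, ratMap_coe, ratMap_coe, num_antipode a hz, den_antipode a hz]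
      by_cases h1 : (num a).eval z = 0
      · have h2 : (den a).eval z ≠ 0 := fun h => h0 ⟨h1, h⟩
        simp [h1, h2, antipode_coe]
      · have h1' : conj ((num a).eval z) ≠ 0 := by simpa using h1
        have hz' : conj z ≠ 0 := by simpa using hz
        by_cases h2 : (den a).eval z = 0
        · simp [h1, h2, hz, antipode_infty]
        · have h2' : conj ((den a).eval z) ≠ 0 := by simpa using h2
          simp [h1, h2, hz, antipode_coe]
          field_simp

lemma cross_eq {p q p' q' : ℂ[X]} (hq : q ≠ 0) (hq' : q' ≠ 0) (h : ratMap p q = ratMap p' q') :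
    p * q' = p' * q := by
  refine eq_of_infinite_eval_eq _ _ ?_
  have hfin : {z : ℂ | (q * q').eval z = 0}.Finite := by
    simpa [IsRoot] using (finite_setOfPred_isRoot (mul_ne_zero hq hq'))
  refine (hfin.infinite_compl).mono fun z hz => ?_
  simp only [Set.mem_compl_iff, Set.mem_ofPred_eq, eval_mul, mul_eq_zero, not_or] at hz
  have := congrFun h (z : OnePoint ℂ)
  rw [ratMap_coe, ratMap_coe, if_neg hz.1, if_neg hz.2, OnePoint.coe_eq_coe,
    div_eq_div_iff hz.1 hz.2] at this
  simpa using this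

lemma den_ne_zero {a : Fin 4 → ℂ} (h : IsCoprime (num a) (den a)) : den a ≠ 0 := by
  intro h0
  rw [h0, isCoprime_zero_right] at h
  have : (num a).natDegree = 0 := natDegree_eq_zero_of_isUnit h
  have ha : ∀ k : Fin 4, a k = 0 := by
    intro k
    have : (den a).coeff (k.rev : Fin 4) = 0 := by rw [h0]; simp
    rw [den_eq, num_coeff] at this
    fin_cases k <;> simpa [Fin.rev] using this
  have : num a = 0 := by simp [num, ha]
  rw [this] at h
  exact not_isUnit_zero h

lemma eq_real_smul {a b : Fin 4 → ℂ} (ha : IsCoprime (num a) (den a))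
    (hb : IsCoprime (num b) (den b)) (h : ratMap (num a) (den a) = ratMap (num b) (den b)) :
    ∃ s : ℝ, ∀ k, b k = (s : ℂ) * a k := by
  have hx := cross_eq (den_ne_zero ha) (den_ne_zero hb) h
  obtain ⟨u, hu⟩ : den a ∣ den b := ha.symm.dvd_of_dvd_mul_left ⟨num b, by rw [hx, mul_comm]⟩
  have hnu : num b = num a * u := by
    have : den a * num b = den a * (num a * u) := by
      rw [mul_comm (den a), ← hx, hu]; ring
    exact mul_left_cancel₀ (den_ne_zero ha) this
  have hunit : IsUnit u := hb.isUnit_of_dvd' ⟨num a, by rw [hnu]; ring⟩ ⟨den a, by rw [hu]; ring⟩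
  obtain ⟨r, hr, rfl⟩ := Polynomial.isUnit_iff.1 hunit
  have hab : ∀ k, b k = r * a k := fun k => by
    rw [← num_coeff b k, hnu, coeff_mul_C, num_coeff, mul_comm]
  have hr' : conj r = r := by
    rw [show b = fun k => r * a k from funext hab, den_smul, mul_comm] at hu
    exact C_injective (mul_left_cancel₀ (den_ne_zero ha) hu)
  obtain ⟨s, rfl⟩ := Complex.conj_eq_iff_real.1 hr'
  exact ⟨s, hab⟩

/-- Each parametrization is injective. -/
theorem lumpChart_injOn (j : Fin 8) : Set.InjOn (lumpChart j) (lumpDom j) := by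
  rintro y ⟨-, hy⟩ y' ⟨-, hy'⟩ h
  obtain ⟨s, hab⟩ := eq_real_smul hy hy' h
  have key : ∀ i : Fin 8, j.insertNth (α := fun _ => ℝ) 1 y' i =
      s * j.insertNth (α := fun _ => ℝ) 1 y i := by
    refine Fin.addCases (m := 4) (n := 4) (fun k => ?_) (fun k => ?_)
    · have := congrArg Complex.re (hab k)
      rwa [Complex.re_ofReal_mul] at this
    · have := congrArg Complex.im (hab k)
      rwa [Complex.im_ofReal_mul] at this
  have hs : s = 1 := by
    have := key j
    rw [Fin.insertNth_apply_same, Fin.insertNth_apply_same, mul_one] at this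
    exact this.symm
  funext k
  have := key (j.succAbove k)
  rw [Fin.insertNth_apply_succAbove, Fin.insertNth_apply_succAbove, hs, one_mul] at this
  exact this.symm

/-- The domains of the parametrizations are open. -/
theorem isOpen_lumpDom (j : Fin 8) : IsOpen (lumpDom j) := by
  have hcoef : ∀ k, Continuous fun y => lumpCoeffs j y k := by
    intro k
    have hi : ∀ i : Fin 8, Continuous fun y : Fin 7 → ℝ =>
        j.insertNth (α := fun _ => ℝ) 1 y i := by
      intro i
      rcases Fin.eq_self_or_eq_succAbove j i with rfl | ⟨k, rfl⟩
      · simpa using continuous_const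
      · simpa using continuous_apply k
    have : (fun y => lumpCoeffs j y k) = fun y =>
        ((j.insertNth (α := fun _ => ℝ) 1 y (Fin.castAdd 4 k) : ℝ) : ℂ) +
        ((j.insertNth (α := fun _ => ℝ) 1 y (Fin.natAdd 4 k) : ℝ) : ℂ) * Complex.I := by
      funext y; exact Complex.mk_eq_add_mul_I _ _
    rw [this]
    have := hi (Fin.castAdd 4 k)
    have := hi (Fin.natAdd 4 k)
    fun_prop
  have hcl : IsClosed {y : Fin 7 → ℝ | ∃ z ∈ Metric.closedBall (0 : ℂ) 1,
      (num (lumpCoeffs j y)).eval z = 0 ∧ (den (lumpCoeffs j y)).eval z = 0} := by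
    have := (isClosedMap_fst_of_compactSpace (X := Fin 7 → ℝ) (Y := Metric.closedBall (0 : ℂ) 1))
      {x | (num (lumpCoeffs j x.1)).eval (x.2 : ℂ) = 0 ∧ (den (lumpCoeffs j x.1)).eval (x.2 : ℂ) = 0}
      (by
        have h0 := hcoef 0
        have h1 := hcoef 1
        have h2 := hcoef 2
        have h3 := hcoef 3
        simp only [num_eval, den_eval]
        refine (isClosed_eq ?_ continuous_const).inter (isClosed_eq ?_ continuous_const)
        · fun_prop
        · have := Complex.continuous_conj
          fun_prop)
    convert this using 1
    ext y
    constructor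
    · rintro ⟨z, hz, h⟩
      exact ⟨(y, ⟨z, hz⟩), h, rfl⟩
    · rintro ⟨⟨y', z⟩, h, rfl⟩
      exact ⟨z, z.2, h⟩
  have : lumpDom j = {y | ∀ k, |y k| < 2} ∩ {y : Fin 7 → ℝ | ∃ z ∈ Metric.closedBall (0 : ℂ) 1,
      (num (lumpCoeffs j y)).eval z = 0 ∧ (den (lumpCoeffs j y)).eval z = 0}ᶜ := by
    ext y
    simp only [lumpDom, isCoprime_iff, Set.mem_ofPred_eq, Set.mem_inter_iff, Set.mem_compl_iff]
    refine and_congr_right fun _ => ⟨fun h ⟨z, _, hz⟩ => h z hz, fun h z hz => ?_⟩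
    by_cases hz1 : ‖z‖ ≤ 1
    · exact h ⟨z, by simpa using hz1, hz⟩
    · have hz0 : z ≠ 0 := by rintro rfl; simp at hz1
      refine h ⟨-1 / conj z, ?_, ?_, ?_⟩
      · simp only [mem_closedBall_zero_iff, norm_div, norm_neg, norm_one, RCLike.norm_conj]
        exact (div_le_one (by positivity)).2 (not_le.1 hz1).le
      · rw [num_antipode _ hz0, hz.2]; simp
      · rw [den_antipode _ hz0, hz.1]; simp
  rw [this]
  refine IsOpen.inter ?_ hcl.isOpen_compl
  rw [Set.ofPred_forall]
  exact isOpen_iInter_of_finite fun k => isOpen_lt (by fun_prop) continuous_const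

lemma exists_coeffs {R : OnePoint ℂ → OnePoint ℂ} (hR : R ∈ RatTilde 3) :
    ∃ a : Fin 4 → ℂ, IsCoprime (num a) (den a) ∧ R = ratMap (num a) (den a) := by
  obtain ⟨⟨p, q, hpq, hdeg, rfl⟩, hanti⟩ := hR
  have hp0 : p ≠ 0 := by
    rintro rfl
    have := natDegree_eq_zero_of_isUnit (isCoprime_zero_left.1 hpq)
    simp [this] at hdeg
  have hq0 : q ≠ 0 := by
    rintro rfl
    have := natDegree_eq_zero_of_isUnit (isCoprime_zero_right.1 hpq)
    simp [this] at hdeg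
  obtain ⟨b, rfl⟩ : ∃ b, p = num b := ⟨_, eq_num (hdeg ▸ le_max_left _ _)⟩
  obtain ⟨d, rfl⟩ : ∃ d, q = num d := ⟨_, eq_num (hdeg ▸ le_max_right _ _)⟩
  have hid : den b * num b = -(den d * num d) := by
    refine eq_of_infinite_eval_eq _ _ ?_
    have hfin : {z : ℂ | (X * num b * num d).eval z = 0}.Finite := by
      simpa [IsRoot] using (finite_setOfPred_isRoot (mul_ne_zero (mul_ne_zero X_ne_zero hp0) hq0))
    refine (hfin.infinite_compl).mono fun z hz => ?_
    simp only [Set.mem_compl_iff, Set.mem_ofPred_eq, eval_mul, eval_X, mul_eq_zero, not_or] at hz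
    obtain ⟨⟨hz, h1⟩, h2⟩ := hz
    have h1' : conj ((num b).eval z) ≠ 0 := by simpa using h1
    have h2' : conj ((num d).eval z) ≠ 0 := by simpa using h2
    have hz' : conj z ≠ 0 := by simpa using hz
    have := hanti (z : OnePoint ℂ)
    rw [antipode_coe, if_neg hz, ratMap_coe, ratMap_coe, if_neg h2, antipode_coe,
      if_neg (div_ne_zero h1 h2)] at this
    split_ifs at this with h3
    · exact absurd this (OnePoint.infty_ne_coe _)
    · rw [OnePoint.coe_eq_coe, div_eq_iff h3, num_antipode b hz, num_antipode d hz] at this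
      simp only [map_div₀, map_neg, map_pow] at this
      field_simp at this
      simp only [Set.mem_ofPred_eq, eval_mul, eval_neg]
      apply (starRingEnd ℂ).injective
      simp only [map_mul, map_neg]
      linear_combination -this
  obtain ⟨s, hs⟩ : num d ∣ den b := hpq.symm.dvd_of_dvd_mul_right (by
    rw [hid]; exact (dvd_mul_left _ _).neg_right)
  have hs' : den d = -(s * num b) := by
    apply mul_left_cancel₀ hq0
    rw [hs] at hid
    linear_combination hid
  have hcoeff : ∀ a : Fin 4 → ℂ, ∀ k : Fin 4, (den a).coeff k = (-1) ^ (k : ℕ) * conj (a k.rev) := by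
    intro a k
    rw [den_eq, num_coeff]
    fin_cases k <;> simp [Fin.rev, pow_succ]
  have hden : ∀ a, num a ≠ 0 → den a ≠ 0 := by
    intro a ha h0
    apply ha
    have : ∀ k, a k = 0 := fun k => by
      have := hcoeff a k.rev
      rw [h0, Fin.rev_rev] at this
      simpa using this
    simp [num, this]
  have hdn : ∀ a, (den a).natDegree ≤ 3 := fun a => by rw [den_eq]; exact num_natDegree _
  have hs0 : s ≠ 0 := by
    rintro rfl
    exact hden b hp0 (by rw [hs, mul_zero])
  have hsd : s.natDegree = 0 := by
    rcases max_choice (num b).natDegree (num d).natDegree with h | h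
    · have h1 := hdn d
      rw [hs', natDegree_neg, natDegree_mul hs0 hp0] at h1
      omega
    · have h1 := hdn b
      rw [hs, natDegree_mul hq0 hs0] at h1
      omega
  obtain ⟨r, rfl⟩ : ∃ r, s = C r := ⟨_, eq_C_of_natDegree_eq_zero hsd⟩
  have hr0 : r ≠ 0 := by rintro rfl; simp at hs0
  have e1 : ∀ k : Fin 4, (-1) ^ (k : ℕ) * conj (b k.rev) = d k * r := fun k => by
    rw [← hcoeff, hs, coeff_mul_C, num_coeff]
  have e2 : ∀ k : Fin 4, (-1) ^ (k : ℕ) * conj (d k.rev) = -(r * b k) := fun k => by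
    rw [← hcoeff, hs', coeff_neg, coeff_C_mul, num_coeff]
  have hr1 : r * conj r = 1 := by
    obtain ⟨k, hk⟩ : ∃ k, b k ≠ 0 := by
      by_contra! h
      exact hp0 (by simp [num, h])
    have h1 := congrArg conj (e1 k.rev)
    have h2 := e2 k
    rw [Fin.rev_rev] at h1
    simp only [map_mul, map_pow, map_neg, map_one, Complex.conj_conj] at h1
    have h3 : ((-1 : ℂ)) ^ (k : ℕ) * (-1) ^ ((k.rev : Fin 4) : ℕ) = -1 := by
      fin_cases k <;> simp [Fin.rev, pow_succ]
    have h4 : b k * (r * conj r - 1) = 0 := by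
      linear_combination (-1 : ℂ) ^ (k : ℕ) * h1 + conj r * h2 - b k * h3
    rcases mul_eq_zero.1 h4 with h | h
    · exact absurd h hk
    · exact sub_eq_zero.1 h
  obtain ⟨m, hm⟩ := IsAlgClosed.exists_pow_nat_eq r (n := 2) (by norm_num)
  have hmn : Complex.normSq m = 1 := by
    have h1 := congrArg Complex.re hr1
    rw [Complex.mul_conj, ← hm, map_pow, Complex.ofReal_re, Complex.one_re] at h1
    nlinarith [Complex.normSq_nonneg m]
  have hm1 : conj m * r = m := by
    have h : m * conj m = 1 := by rw [Complex.mul_conj, hmn]; simp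
    rw [← hm]; linear_combination m * h
  have hm0 : m ≠ 0 := by rintro rfl; simp at hmn
  have hd : den (fun k => m * b k) = C m * num d := by
    rw [den_smul, hs]
    calc C (conj m) * (num d * C r) = C (conj m * r) * num d := by rw [C_mul]; ring
      _ = _ := by rw [hm1]
  refine ⟨fun k => m * b k, ?_, ?_⟩
  · rw [num_smul, hd]
    have hu : IsUnit (C m : ℂ[X]) := isUnit_C.2 hm0.isUnit
    exact (isCoprime_mul_unit_left hu _ _).2 hpq
  · rw [num_smul, hd, ratMap_C_mul _ _ hm0]

/-- The images of the parametrizations cover exactly the moduli space. -/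
theorem iUnion_lumpChart : ⋃ j, lumpChart j '' lumpDom j = RatTilde 3 := by
  apply Set.Subset.antisymm
  · refine Set.iUnion_subset fun j => ?_
    rintro _ ⟨y, ⟨-, hy⟩, rfl⟩
    exact ratMap_mem hy
  · intro R hR
    obtain ⟨a, ha, rfl⟩ := exists_coeffs hR
    let x : Fin 8 → ℝ := Fin.addCases (m := 4) (n := 4) (fun k => (a k).re) (fun k => (a k).im)
    have hxl : ∀ k : Fin 4, x (Fin.castAdd 4 k) = (a k).re := fun k => Fin.addCases_left k
    have hxr : ∀ k : Fin 4, x (Fin.natAdd 4 k) = (a k).im := fun k => Fin.addCases_right k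
    obtain ⟨j, hj⟩ := Finite.exists_max fun i => |x i|
    have hj0 : x j ≠ 0 := by
      intro h
      have h0 : ∀ i, x i = 0 := fun i => by
        have := hj i
        rw [h, abs_zero] at this
        exact abs_eq_zero.1 (le_antisymm this (abs_nonneg _))
      have : a = 0 := funext fun k => Complex.ext (by rw [← hxl, h0]; rfl) (by rw [← hxr, h0]; rfl)
      exact den_ne_zero ha (by simp [this, den])
    have hco : lumpCoeffs j (fun k => (x j)⁻¹ * x (j.succAbove k)) =
        fun k => (((x j)⁻¹ : ℝ) : ℂ) * a k := by
      have h : j.insertNth (α := fun _ => ℝ) 1 (fun k => (x j)⁻¹ * x (j.succAbove k)) =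
          fun i => (x j)⁻¹ * x i := by
        rw [Fin.insertNth_eq_iff]
        exact ⟨(inv_mul_cancel₀ hj0).symm, rfl⟩
      funext k
      rw [lumpCoeffs, h]
      apply Complex.ext
      · rw [Complex.re_ofReal_mul, ← hxl]; rfl
      · rw [Complex.im_ofReal_mul, ← hxr]; rfl
    have hr : (((x j)⁻¹ : ℝ) : ℂ) ≠ 0 := by exact_mod_cast inv_ne_zero hj0
    refine Set.mem_iUnion.2 ⟨j, fun k => (x j)⁻¹ * x (j.succAbove k), ⟨fun k => ?_, ?_⟩, ?_⟩
    · rw [abs_mul, abs_inv, inv_mul_eq_div, div_lt_iff₀ (abs_pos.2 hj0)]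
      have := hj (j.succAbove k)
      have := abs_pos.2 hj0
      linarith
    · rw [hco, num_smul, den_smul, Complex.conj_ofReal]
      exact (isCoprime_mul_unit_left (isUnit_C.2 hr.isUnit) _ _).2 ha
    · rw [lumpChart, hco, num_smul, den_smul, Complex.conj_ofReal, ratMap_C_mul _ _ hr]

/-- The Riemannian volume of the moduli space of charge three lumps on the real projective
plane, for the `L²` metric. -/
def lumpVolume : ENNReal := atlasVolume lumpDom lumpChart

/-! ### The parametrization by symmetry orbits -/

/-- The `D₂`-symmetric map `(z³ + c z) / (c z² + 1)`. -/
def Rc (c : ℝ) : OnePoint ℂ → OnePoint ℂ :=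
  ratMap (X ^ 3 + C (c : ℂ) * X) (C (c : ℂ) * X ^ 2 + 1)

/-- The basis `(i/2) τ_a` of the Lie algebra of `SU(2)`, with `τ_a` the Pauli matrices. -/
def su2Basis : Fin 3 → Matrix (Fin 2) (Fin 2) ℂ :=
  ![!![0, Complex.I / 2; Complex.I / 2, 0],
    !![0, 1 / 2; -1 / 2, 0],
    !![Complex.I / 2, 0; 0, -Complex.I / 2]]

/-- The element `∑ ξ_a (i/2) τ_a` of the Lie algebra of `SU(2)`. -/
def su2 (ξ : Fin 3 → ℝ) : Matrix (Fin 2) (Fin 2) ℂ := ∑ a, (ξ a : ℂ) • su2Basis a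

/-- The map `z ↦ M(R_c(U z))`, where matrices act by Möbius transformations. -/
def orbitMap (U M : GL (Fin 2) ℂ) (c : ℝ) : OnePoint ℂ → OnePoint ℂ :=
  fun z => M • Rc c (U • z)

/-- The vector fields on the sphere that generate the rotations about the three axes. -/
def rotField (i : Fin 3) (z : ℂ) : ℂ :=
  ![Complex.I / 2 * (1 - z ^ 2), (1 + z ^ 2) / 2, Complex.I * z] i

/-- `A_ii(c) = ∫ |v_i(z)|² |R_c'|² / (1 + |R_c|²)² dA / (1 + |z|²)²`, `v_i` the rotation fields. -/
def metricA (i : Fin 3) (c : ℝ) : ℝ :=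
  ∫ z : ℂ, ‖rotField i z‖ ^ 2 * ‖deriv (affine (Rc c)) z‖ ^ 2 /
    ((1 + ‖affine (Rc c) z‖ ^ 2) ^ 2 * (1 + ‖z‖ ^ 2) ^ 2)

/-- `D_ii(c) = ∫ |v_i(R_c)|² / (1 + |R_c|²)² dA / (1 + |z|²)²`. -/
def metricD (i : Fin 3) (c : ℝ) : ℝ :=
  ∫ z : ℂ, ‖rotField i (affine (Rc c) z)‖ ^ 2 /
    ((1 + ‖affine (Rc c) z‖ ^ 2) ^ 2 * (1 + ‖z‖ ^ 2) ^ 2)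

/-- `F_ii(c) = 2 ∫ Re(v_i(z) R_c' conj(v_i(R_c))) / (1 + |R_c|²)² dA / (1 + |z|²)²`. -/
def metricF (i : Fin 3) (c : ℝ) : ℝ :=
  2 * ∫ z : ℂ, (rotField i z * deriv (affine (Rc c)) z * conj (rotField i (affine (Rc c) z))).re /
    ((1 + ‖affine (Rc c) z‖ ^ 2) ^ 2 * (1 + ‖z‖ ^ 2) ^ 2)

/-- `C(c) = ∫ |∂_c R_c|² / (1 + |R_c|²)² dA / (1 + |z|²)²`. -/
def metricC (c : ℝ) : ℝ :=
  ∫ z : ℂ, ‖deriv (fun s : ℝ => affine (Rc s) z) c‖ ^ 2 /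
    ((1 + ‖affine (Rc c) z‖ ^ 2) ^ 2 * (1 + ‖z‖ ^ 2) ^ 2)

end Lump

end

/-!
Write `R = P / Q` and `E = |P|² + |Q|²`. A deformation of `R` has the derivative `W / Q²` with
`deg W ≤ 2n`, so the `L²` density is `Re (W W̄') / (E² (1 + |z|²)²)`. It is integrable because `E`
is at least a multiple of `(1 + |z|²) ^ n` when `P` and `Q` are coprime.

On the orbits, a change of variables by `U` and the invariance of the target metric under `M`
reduce the inner product to the map `R_c`. This map is equivariant under the isometries `z ↦ -z`
and `z ↦ z̄`, under which `∂_c` and the three pairs `(σ_i, η_i)` have four different characters, so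
the mixed terms vanish.

For the volume, `|W|² ≤ E_v E_a` and the antipodal symmetry bound the metric coefficients by
`∫_D 1 / E` over the unit disc. The common roots of numerator and denominator are simple, so
`∫_D E ^ (-s)` is bounded for every `s < 1`, while `E` is at least a multiple of the squared
resultant. Interpolating, `√(det g) ≤ C |Res| ^ (-1/12)`. Along a coordinate direction, the
resultant is the determinant of a linear pencil, hence a polynomial of degree `6` in one real
variable with a nonzero constant leading coefficient, and `6 / 12 < 1` makes the bound integrable.
-/

noncomputable section

namespace Lump

section NegativePowers

open Metric Topology

lemma rpow_neg_le_rpow_neg {x y : ENNReal} {s : ℝ} (hs : 0 ≤ s) (h : x ≤ y) :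
    y ^ (-s) ≤ x ^ (-s) := by
  rw [ENNReal.rpow_neg, ENNReal.rpow_neg, ENNReal.inv_le_inv]
  exact ENNReal.rpow_le_rpow h hs

lemma half_mul_dist_le_norm_of_isMinOn {E F : Type*} [PseudoMetricSpace E]
    [SeminormedAddCommGroup F] {K : Set E} {f : E → F} {c : ℝ}
    (hf : ∀ z ∈ K, ∀ w ∈ K, c * dist z w ≤ ‖f z - f w‖) {w : E} (hw : w ∈ K)
    (hmin : IsMinOn (fun z => ‖f z‖) K w) {z : E} (hz : z ∈ K) :
    c / 2 * dist z w ≤ ‖f z‖ := by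
  have h₁ := hf z hz w hw
  have h₂ : ‖f w‖ ≤ ‖f z‖ := hmin hz
  have h₃ := norm_sub_le (f z) (f w)
  linarith

variable {E F : Type*} [NormedAddCommGroup E] [NormedSpace ℝ E] [FiniteDimensional ℝ E]
  [MeasurableSpace E] [BorelSpace E] (μ : Measure E) [μ.IsAddHaarMeasure] [NormedAddCommGroup F]

lemma lintegral_ball_enorm_rpow_neg_lt_top (hd : 0 < Module.finrank ℝ E) {α : ℝ}
    (hα : α < Module.finrank ℝ E) (r : ℝ) :
    ∫⁻ x in ball (0 : E) r, ‖x‖ₑ ^ (-α) ∂μ < ⊤ := by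
  have : Nontrivial E := Module.nontrivial_of_finrank_pos hd
  have hmeas : Measurable fun x : E => ‖x‖ ^ (-α) := by fun_prop
  have hint : IntegrableOn (fun x : E => ‖x‖ ^ (-α)) (ball 0 r) μ :=
    integrableOn_ball_of_norm_le_rpow (C := 1) hd hα
      (.of_forall fun x => by rw [one_mul, Real.norm_of_nonneg (by positivity)])
      hmeas.aestronglyMeasurable
  refine lt_of_eq_of_lt (lintegral_congr_ae (ae_restrict_of_ae ?_)) hint.2
  filter_upwards [compl_mem_ae_iff.2 (measure_singleton (0 : E))] with x hx
  rw [← ofReal_norm, ← ofReal_norm, ENNReal.ofReal_rpow_of_pos (norm_pos_iff.2 hx),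
    Real.norm_of_nonneg (by positivity)]

lemma setLIntegral_enorm_rpow_neg_le {z₀ : E} {r : ℝ} (hr : 0 ≤ r) {f : E → F} {c : ℝ}
    (hc : 0 < c) (hcont : ContinuousOn f (closedBall z₀ r))
    (hf : ∀ z ∈ closedBall z₀ r, ∀ w ∈ closedBall z₀ r, c * dist z w ≤ ‖f z - f w‖)
    {α : ℝ} (hα : 0 ≤ α) :
    ∫⁻ z in closedBall z₀ r, ‖f z‖ₑ ^ (-α) ∂μ ≤
      ENNReal.ofReal (c / 2) ^ (-α) * ∫⁻ x in ball (0 : E) (2 * r + 1), ‖x‖ₑ ^ (-α) ∂μ := by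
  have : ProperSpace E := FiniteDimensional.proper_real E
  obtain ⟨w, hw, hmin⟩ := (isCompact_closedBall z₀ r).exists_isMinOn
    ⟨z₀, mem_closedBall_self hr⟩ hcont.norm
  set g : E → ENNReal := (ball 0 (2 * r + 1)).indicator fun x => ‖x‖ₑ ^ (-α)
  have hle (z : E) (hz : z ∈ closedBall z₀ r) :
      ‖f z‖ₑ ^ (-α) ≤ ENNReal.ofReal (c / 2) ^ (-α) * g (z - w) := by
    have hzw : z - w ∈ ball (0 : E) (2 * r + 1) := by
      rw [mem_ball_zero_iff, ← dist_eq_norm]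
      linarith [dist_triangle_right z w z₀, mem_closedBall.1 hz, mem_closedBall.1 hw]
    rw [show g (z - w) = ‖z - w‖ₑ ^ (-α) from Set.indicator_of_mem hzw _,
      ← ENNReal.mul_rpow_of_ne_top (by simp) (by simp)]
    refine rpow_neg_le_rpow_neg hα ?_
    rw [← ofReal_norm, ← ofReal_norm, ← ENNReal.ofReal_mul (by positivity), ← dist_eq_norm]
    exact ENNReal.ofReal_le_ofReal (half_mul_dist_le_norm_of_isMinOn hf hw hmin hz)
  have hfin : ENNReal.ofReal (c / 2) ^ (-α) ≠ ⊤ := by simp [ENNReal.rpow_eq_top_iff, hc]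
  calc ∫⁻ z in closedBall z₀ r, ‖f z‖ₑ ^ (-α) ∂μ
      ≤ ∫⁻ z in closedBall z₀ r, ENNReal.ofReal (c / 2) ^ (-α) * g (z - w) ∂μ :=
        setLIntegral_mono' isClosed_closedBall.measurableSet hle
    _ ≤ ∫⁻ z, ENNReal.ofReal (c / 2) ^ (-α) * g (z - w) ∂μ := setLIntegral_le_lintegral _ _
    _ = ENNReal.ofReal (c / 2) ^ (-α) * ∫⁻ x in ball (0 : E) (2 * r + 1), ‖x‖ₑ ^ (-α) ∂μ := by
        rw [lintegral_const_mul' _ _ hfin, lintegral_sub_right_eq_self g,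
          lintegral_indicator isOpen_ball.measurableSet]

lemma exists_nhds_mul_dist_le_norm_sub {X 𝕜 : Type*} [TopologicalSpace X] [RCLike 𝕜]
    {f f' : X → 𝕜 → 𝕜} (hf : ∀ x z, HasDerivAt (f x) (f' x z) z) {x₀ : X} {z₀ : 𝕜}
    (hf' : ContinuousAt (Function.uncurry f') (x₀, z₀)) (h0 : f' x₀ z₀ ≠ 0) :
    ∃ N ∈ 𝓝 x₀, ∃ r > 0, ∃ c > 0, ∀ x ∈ N, ∀ z ∈ closedBall z₀ r, ∀ w ∈ closedBall z₀ r,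
      c * dist z w ≤ ‖f x z - f x w‖ := by
  set d := f' x₀ z₀
  have hd : 0 < ‖d‖ / 2 := by simpa using h0
  obtain ⟨N, hN, V, hV, hNV⟩ := mem_nhds_prod_iff.1 (hf' (ball_mem_nhds d hd))
  obtain ⟨r, hr, hrV⟩ := nhds_basis_closedBall.mem_iff.1 hV
  refine ⟨N, hN, r, hr, ‖d‖ / 2, hd, fun x hx z hz w hw => ?_⟩
  have hderiv (u : 𝕜) : HasDerivAt (fun u => f x u - d * u) (f' x u - d) u := by
    simpa only [mul_one] using HasDerivAt.fun_sub (hf x u) ((hasDerivAt_id' u).const_mul d)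
  have hbound (u : 𝕜) (hu : u ∈ closedBall z₀ r) : ‖f' x u - d‖ ≤ ‖d‖ / 2 := by
    rw [← dist_eq_norm]
    exact (mem_ball.1 (hNV (Set.mk_mem_prod hx (hrV hu)))).le
  have hclose := (convex_closedBall z₀ r).norm_image_sub_le_of_norm_hasDerivWithin_le
    (fun u _ => (hderiv u).hasDerivWithinAt) hbound hw hz
  have hlin : d * (z - w) = (f x z - f x w) - ((f x z - d * z) - (f x w - d * w)) := by ring
  have := norm_sub_le (f x z - f x w) ((f x z - d * z) - (f x w - d * w))
  rw [← hlin, norm_mul] at this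
  rw [dist_eq_norm]
  linarith

lemma exists_nhds_setLIntegral_le_of_eventually_le {X Y : Type*} [TopologicalSpace X]
    [TopologicalSpace Y] [MeasurableSpace Y] [OpensMeasurableSpace Y] (μ : Measure Y)
    [IsLocallyFiniteMeasure μ] {g : X → Y → ENNReal} {x₀ : X} {y₀ : Y} {B : ENNReal} (hB : B ≠ ⊤)
    (hg : ∀ᶠ p in 𝓝 (x₀, y₀), g p.1 p.2 ≤ B) :
    ∃ U ∈ 𝓝 x₀, ∃ V ∈ 𝓝 y₀, ∃ C ≠ ⊤, ∀ x ∈ U, ∫⁻ y in V, g x y ∂μ ≤ C := by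
  obtain ⟨U, hU, W, hW, hUW⟩ := mem_nhds_prod_iff.1 hg
  obtain ⟨T, hT, hTμ⟩ := μ.finiteAt_nhds y₀
  obtain ⟨V, hVWT, hVopen, hyV⟩ := mem_nhds_iff.1 (Filter.inter_mem hW hT)
  have hVμ : μ V < ⊤ := (measure_mono fun y hy => (hVWT hy).2).trans_lt hTμ
  refine ⟨U, hU, V, hVopen.mem_nhds hyV, B * μ V, ENNReal.mul_ne_top hB hVμ.ne, fun x hx => ?_⟩
  rw [← setLIntegral_const]
  exact setLIntegral_mono' hVopen.measurableSet fun y hy => hUW (Set.mk_mem_prod hx (hVWT hy).1)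

lemma exists_setLIntegral_le_of_isCompact {X Y : Type*} [TopologicalSpace X] [TopologicalSpace Y]
    [MeasurableSpace Y] (μ : Measure Y) {g : X → Y → ENNReal} {K : Set X} (hK : IsCompact K)
    {L : Set Y} (hL : IsCompact L)
    (h : ∀ x₀ ∈ K, ∀ y₀ ∈ L, ∃ U ∈ 𝓝 x₀, ∃ V ∈ 𝓝 y₀, ∃ C ≠ ⊤,
      ∀ x ∈ U, ∫⁻ y in V, g x y ∂μ ≤ C) :
    ∃ C ≠ ⊤, ∀ x ∈ K, ∫⁻ y in L, g x y ∂μ ≤ C := by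
  obtain ⟨C, hC, hle⟩ : ∃ C ≠ ⊤, ∀ x, ∫⁻ y in {y | (x, y) ∈ K ×ˢ L}, g x y ∂μ ≤ C := by
    refine (hK.prod hL).induction_on
      (p := fun S => ∃ C ≠ ⊤, ∀ x, ∫⁻ y in {y | (x, y) ∈ S}, g x y ∂μ ≤ C) ?_ ?_ ?_ ?_
    · exact ⟨0, by simp, by simp⟩
    · rintro S T hST ⟨C, hC, hle⟩
      exact ⟨C, hC, fun x => (lintegral_mono_set (Set.preimage_mono hST)).trans (hle x)⟩
    · rintro S T ⟨C, hC, hle⟩ ⟨C', hC', hle'⟩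
      refine ⟨C + C', ENNReal.add_ne_top.2 ⟨hC, hC'⟩, fun x => ?_⟩
      exact (lintegral_union_le _ _ _).trans (add_le_add (hle x) (hle' x))
    · rintro ⟨x₀, y₀⟩ ⟨hx₀, hy₀⟩
      obtain ⟨U, hU, V, hV, C, hC, hle⟩ := h x₀ hx₀ y₀ hy₀
      refine ⟨U ×ˢ V, mem_nhdsWithin_of_mem_nhds (prod_mem_nhds hU hV), C, hC, fun x => ?_⟩
      by_cases hx : x ∈ U
      · simpa [hx] using hle x hx
      · simp [hx]
  refine ⟨C, hC, fun x hx => (lintegral_mono_set fun y hy => ?_).trans (hle x)⟩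
  exact Set.mk_mem_prod hx hy

lemma exists_nhds_setLIntegral_enorm_rpow_neg_le {X : Type*} [TopologicalSpace X] {𝕜 : Type*}
    [RCLike 𝕜] [MeasurableSpace 𝕜] [BorelSpace 𝕜] (μ : Measure 𝕜) [μ.IsAddHaarMeasure]
    {f f' : X → 𝕜 → 𝕜} (hf : ∀ x z, HasDerivAt (f x) (f' x z) z) {x₀ : X} {z₀ : 𝕜}
    (hcont : ContinuousAt (Function.uncurry f) (x₀, z₀))
    (hcont' : ContinuousAt (Function.uncurry f') (x₀, z₀)) (h0 : f x₀ z₀ ≠ 0 ∨ f' x₀ z₀ ≠ 0)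
    {α : ℝ} (hα0 : 0 ≤ α) (hα : α < Module.finrank ℝ 𝕜) :
    ∃ U ∈ 𝓝 x₀, ∃ V ∈ 𝓝 z₀, ∃ C ≠ ⊤, ∀ x ∈ U, ∫⁻ z in V, ‖f x z‖ₑ ^ (-α) ∂μ ≤ C := by
  rcases h0 with h0 | h0
  · refine exists_nhds_setLIntegral_le_of_eventually_le μ
      (B := ENNReal.ofReal (‖f x₀ z₀‖ / 2) ^ (-α)) (by simp [ENNReal.rpow_eq_top_iff, h0]) ?_
    have hev : ∀ᶠ p in 𝓝 (x₀, z₀), ‖f x₀ z₀‖ / 2 < ‖f p.1 p.2‖ :=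
      hcont.norm.eventually (lt_mem_nhds (half_lt_self (norm_pos_iff.2 h0)))
    filter_upwards [hev] with p hp
    refine rpow_neg_le_rpow_neg hα0 ?_
    rw [← ofReal_norm]
    exact ENNReal.ofReal_le_ofReal hp.le
  · obtain ⟨U, hU, r, hr, c, hc, hfc⟩ := exists_nhds_mul_dist_le_norm_sub hf hcont' h0
    refine ⟨U, hU, closedBall z₀ r, closedBall_mem_nhds _ hr,
      ENNReal.ofReal (c / 2) ^ (-α) * ∫⁻ z in ball (0 : 𝕜) (2 * r + 1), ‖z‖ₑ ^ (-α) ∂μ,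
      ENNReal.mul_ne_top (by simp [ENNReal.rpow_eq_top_iff, hc]) ?_, fun x hx => ?_⟩
    · exact (lintegral_ball_enorm_rpow_neg_lt_top μ Module.finrank_pos hα _).ne
    · exact setLIntegral_enorm_rpow_neg_le μ hr.le hc
        (fun z _ => (hf x z).continuousAt.continuousWithinAt) (hfc x hx) hα0

end NegativePowers

section Energy

/-- The energy `|p|² + |q|²` of a pair of polynomials. For the rational map `R = p / q` it is
`|q|² (1 + |R|²)`, so it extends the density of the round metric on the target to the poles. -/
def energy (p q : ℂ[X]) (z : ℂ) : ℝ := ‖p.eval z‖ ^ 2 + ‖q.eval z‖ ^ 2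

lemma energy_nonneg (p q : ℂ[X]) (z : ℂ) : 0 ≤ energy p q z := by
  unfold energy; positivity

@[fun_prop]
lemma continuous_energy (p q : ℂ[X]) : Continuous (energy p q) := by
  unfold energy; fun_prop

lemma energy_pos_iff {p q : ℂ[X]} {z : ℂ} :
    0 < energy p q z ↔ ¬(p.eval z = 0 ∧ q.eval z = 0) := by
  rw [(energy_nonneg p q z).lt_iff_ne', energy, Ne, add_eq_zero_iff_of_nonneg (sq_nonneg _)
    (sq_nonneg _), sq_eq_zero_iff, sq_eq_zero_iff, norm_eq_zero, norm_eq_zero]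

lemma energy_pos {p q : ℂ[X]} (h : IsCoprime p q) (z : ℂ) : 0 < energy p q z :=
  energy_pos_iff.2 ((isCoprime_iff p q).1 h z)

lemma eval_eq_pow_mul_eval_reflect_inv {p : ℂ[X]} {n : ℕ} (hp : p.natDegree ≤ n) {z : ℂ}
    (hz : z ≠ 0) : p.eval z = z ^ n * (p.reflect n).eval z⁻¹ := by
  have := invertibleOfNonzero hz
  simpa [mul_comm] using (eval₂_reflect_mul_pow (RingHom.id ℂ) z n p hp).symm

lemma energy_eq_pow_mul_energy_reflect {p q : ℂ[X]} {n : ℕ} (hp : p.natDegree ≤ n)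
    (hq : q.natDegree ≤ n) {z : ℂ} (hz : z ≠ 0) :
    energy p q z = (‖z‖ ^ 2) ^ n * energy (p.reflect n) (q.reflect n) z⁻¹ := by
  rw [energy, energy, eval_eq_pow_mul_eval_reflect_inv hp hz,
    eval_eq_pow_mul_eval_reflect_inv hq hz, norm_mul, norm_mul, norm_pow]
  ring

lemma eq_zero_and_eq_zero_of_coeff_eq_zero {p q : ℂ[X]} {n : ℕ} (hp : p.natDegree = n)
    (hq : q.natDegree ≤ n) (hpn : p.coeff n = 0) (hqn : q.coeff n = 0) : p = 0 ∧ q = 0 := by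
  have hp0 : p = 0 := leadingCoeff_eq_zero.1 (by rwa [leadingCoeff, hp])
  have hn : n = 0 := by rw [← hp, hp0, natDegree_zero]
  subst hn
  exact ⟨hp0, by rw [eq_C_of_natDegree_le_zero hq, hqn, C_0]⟩

lemma energy_reflect_pos {p q : ℂ[X]} (h : IsCoprime p q) (z : ℂ) :
    0 < energy (p.reflect (max p.natDegree q.natDegree))
      (q.reflect (max p.natDegree q.natDegree)) z := by
  rcases eq_or_ne z 0 with rfl | hz
  · rw [energy_pos_iff, ← coeff_zero_eq_eval_zero, ← coeff_zero_eq_eval_zero]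
    simp only [coeff_reflect, revAt_zero]
    rintro ⟨hp, hq⟩
    have hpq : p = 0 ∧ q = 0 := by
      rcases max_choice p.natDegree q.natDegree with hmax | hmax
      · exact eq_zero_and_eq_zero_of_coeff_eq_zero hmax.symm (le_max_right _ _) hp hq
      · exact (eq_zero_and_eq_zero_of_coeff_eq_zero hmax.symm (le_max_left _ _) hq hp).symm
    exact (isCoprime_iff p q).1 h 0 (by simp [hpq])
  · have hpos := energy_pos h z⁻¹
    rw [energy_eq_pow_mul_energy_reflect (le_max_left _ q.natDegree) (le_max_right p.natDegree _)
      (inv_ne_zero hz), inv_inv] at hpos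
    exact pos_of_mul_pos_right hpos (by positivity)

lemma exists_mul_pow_le_energy {p q : ℂ[X]} (h : IsCoprime p q) :
    ∃ ε > 0, ∀ z, ε * (1 + ‖z‖ ^ 2) ^ max p.natDegree q.natDegree ≤ energy p q z := by
  set n := max p.natDegree q.natDegree
  have hmin (f : ℂ → ℝ) (hf : Continuous f) (hpos : ∀ z, 0 < f z) :
      ∃ δ > 0, ∀ z, ‖z‖ ≤ 1 → δ ≤ f z := by
    obtain ⟨w, -, hw⟩ := (isCompact_closedBall (0 : ℂ) 1).exists_isMinOn ⟨0, by simp⟩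
      hf.continuousOn
    exact ⟨f w, hpos w, fun z hz => hw (mem_closedBall_zero_iff.2 hz)⟩
  obtain ⟨δ₀, hδ₀, hle₀⟩ := hmin _ (continuous_energy p q) (energy_pos h)
  obtain ⟨δ₁, hδ₁, hle₁⟩ := hmin _ (continuous_energy _ _) (energy_reflect_pos h)
  refine ⟨min δ₀ δ₁ / 2 ^ n, div_pos (lt_min hδ₀ hδ₁) (by positivity), fun z => ?_⟩
  rw [div_mul_eq_mul_div, mul_div_assoc, ← div_pow]
  rcases le_total ‖z‖ 1 with hz | hz
  · calc min δ₀ δ₁ * ((1 + ‖z‖ ^ 2) / 2) ^ n ≤ δ₀ * 1 := by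
          gcongr
          · exact min_le_left _ _
          · exact pow_le_one₀ (by positivity) (by nlinarith [norm_nonneg z])
      _ ≤ energy p q z := by rw [mul_one]; exact hle₀ z hz
  · have hz0 : z ≠ 0 := norm_pos_iff.1 (zero_lt_one.trans_le hz)
    rw [energy_eq_pow_mul_energy_reflect (le_max_left _ q.natDegree) (le_max_right p.natDegree _)
      hz0, mul_comm]
    gcongr
    · nlinarith
    · refine (min_le_right _ _).trans (hle₁ _ ?_)
      rw [norm_inv]
      exact inv_le_one_of_one_le₀ hz

lemma exists_norm_eval_sq_le {p : ℂ[X]} {n : ℕ} (hp : p.natDegree ≤ n) :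
    ∃ K, 0 ≤ K ∧ ∀ z, ‖p.eval z‖ ^ 2 ≤ K * (1 + ‖z‖ ^ 2) ^ n := by
  refine ⟨(∑ k ∈ Finset.range (n + 1), ‖p.coeff k‖) ^ 2, by positivity, fun z => ?_⟩
  have hz : ‖z‖ ≤ √(1 + ‖z‖ ^ 2) := Real.le_sqrt_of_sq_le (by linarith)
  have hone : 1 ≤ √(1 + ‖z‖ ^ 2) := Real.one_le_sqrt.2 (by linarith [sq_nonneg ‖z‖])
  have hsum : ‖p.eval z‖ ≤ (∑ k ∈ Finset.range (n + 1), ‖p.coeff k‖) * √(1 + ‖z‖ ^ 2) ^ n := by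
    rw [eval_eq_sum_range' (Nat.lt_succ_of_le hp), Finset.sum_mul]
    refine norm_sum_le_of_le _ fun k hk => ?_
    rw [norm_mul, norm_pow]
    gcongr
    calc ‖z‖ ^ k ≤ √(1 + ‖z‖ ^ 2) ^ k := by gcongr
      _ ≤ √(1 + ‖z‖ ^ 2) ^ n := pow_le_pow_right₀ hone (Finset.mem_range_succ_iff.1 hk)
  calc ‖p.eval z‖ ^ 2
      ≤ ((∑ k ∈ Finset.range (n + 1), ‖p.coeff k‖) * √(1 + ‖z‖ ^ 2) ^ n) ^ 2 := by gcongr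
    _ = (∑ k ∈ Finset.range (n + 1), ‖p.coeff k‖) ^ 2 * (1 + ‖z‖ ^ 2) ^ n := by
        rw [mul_pow, pow_right_comm, Real.sq_sqrt (by positivity)]

lemma exists_energy_le {p q : ℂ[X]} {n : ℕ} (hp : p.natDegree ≤ n) (hq : q.natDegree ≤ n) :
    ∃ K, ∀ z, energy p q z ≤ K * (1 + ‖z‖ ^ 2) ^ n := by
  obtain ⟨K, -, hK⟩ := exists_norm_eval_sq_le hp
  obtain ⟨L, -, hL⟩ := exists_norm_eval_sq_le hq
  exact ⟨K + L, fun z => (add_le_add (hK z) (hL z)).trans_eq (add_mul K L _).symm⟩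

end Energy

section Density

lemma affine_ratMap (p q : ℂ[X]) (z : ℂ) : affine (ratMap p q) z = p.eval z / q.eval z := by
  rw [affine, ratMap_coe]
  split_ifs with h
  · simp [h]
  · rfl

lemma ae_eval_ne_zero {p : ℂ[X]} (hp : p ≠ 0) : ∀ᵐ z : ℂ, p.eval z ≠ 0 := by
  rw [ae_iff]
  simpa [IsRoot] using (finite_setOfPred_isRoot hp).measure_zero volume

lemma l2Density_ratMap {p q : ℂ[X]} {u v : ℂ → ℂ} {z w w' : ℂ} (hz : q.eval z ≠ 0)
    (hu : u z = w / q.eval z ^ 2) (hv : v z = w' / q.eval z ^ 2) :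
    l2Density (ratMap p q) u v z =
      (w * conj w').re / (energy p q z ^ 2 * (1 + ‖z‖ ^ 2) ^ 2) := by
  have hq : ‖q.eval z‖ ≠ 0 := norm_ne_zero_iff.2 hz
  have hnum : (u z * conj (v z)).re = (w * conj w').re / ‖q.eval z‖ ^ 4 := by
    have hmul : u z * conj (v z) = w * conj w' / ((‖q.eval z‖ ^ 4 : ℝ) : ℂ) := by
      rw [hu, hv, map_div₀, map_pow, div_mul_div_comm, ← mul_pow, Complex.mul_conj']
      push_cast
      ring
    rw [hmul, Complex.div_ofReal_re]
  have hden : 1 + ‖affine (ratMap p q) z‖ ^ 2 = energy p q z / ‖q.eval z‖ ^ 2 := by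
    rw [affine_ratMap, norm_div, div_pow, energy]
    field_simp
    ring
  rw [l2Density, hnum, hden]
  field_simp

lemma integrable_inv_one_add_norm_sq_sq :
    Integrable fun z : ℂ => ((1 + ‖z‖ ^ 2) ^ 2)⁻¹ := by
  have := integrable_rpow_neg_one_add_norm_sq (E := ℂ) (μ := volume) (r := 4)
    (by rw [Complex.finrank_real_complex]; norm_num)
  refine this.congr (.of_forall fun z => ?_)
  simp only [show -(4 : ℝ) / 2 = -((2 : ℕ) : ℝ) by norm_num]
  rw [Real.rpow_neg (by positivity), Real.rpow_natCast]

lemma abs_re_mul_conj_le {w w' : ℂ} {B : ℝ} (hw : ‖w‖ ^ 2 ≤ B) (hw' : ‖w'‖ ^ 2 ≤ B) :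
    |(w * conj w').re| ≤ B := by
  calc |(w * conj w').re| ≤ ‖w‖ * ‖w'‖ := by
        simpa only [norm_mul, RCLike.norm_conj] using Complex.abs_re_le_norm (w * conj w')
    _ ≤ B := by nlinarith [sq_nonneg (‖w‖ - ‖w'‖)]

theorem integrable_l2Density_ratMap {p q : ℂ[X]} (h : IsCoprime p q) (hq : q ≠ 0) {W W' : ℂ[X]}
    (hW : W.natDegree ≤ 2 * max p.natDegree q.natDegree)
    (hW' : W'.natDegree ≤ 2 * max p.natDegree q.natDegree) {u v : ℂ → ℂ}
    (hu : ∀ z, q.eval z ≠ 0 → u z = W.eval z / q.eval z ^ 2)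
    (hv : ∀ z, q.eval z ≠ 0 → v z = W'.eval z / q.eval z ^ 2) :
    Integrable (l2Density (ratMap p q) u v) := by
  set n := max p.natDegree q.natDegree
  obtain ⟨ε, hε, hle⟩ := exists_mul_pow_le_energy h
  obtain ⟨K, hK, hKW⟩ := exists_norm_eval_sq_le hW
  obtain ⟨K', hK', hKW'⟩ := exists_norm_eval_sq_le hW'
  have heq : (fun z => (W.eval z * conj (W'.eval z)).re / (energy p q z ^ 2 * (1 + ‖z‖ ^ 2) ^ 2))
      =ᵐ[volume] l2Density (ratMap p q) u v := by
    filter_upwards [ae_eval_ne_zero hq] with z hz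
    rw [l2Density_ratMap hz (hu z hz) (hv z hz)]
  have hpos := energy_pos h
  refine Integrable.congr ((integrable_inv_one_add_norm_sq_sq.const_mul
    ((K + K') / ε ^ 2)).mono' ?_ (.of_forall fun z => ?_)) heq
  · refine (Continuous.div (by fun_prop) (by fun_prop) fun z => ?_).aestronglyMeasurable
    have := hpos z
    positivity
  · have hre : |(W.eval z * conj (W'.eval z)).re| ≤ (K + K') * ((1 + ‖z‖ ^ 2) ^ n) ^ 2 := by
      rw [← pow_mul, mul_comm n]
      refine abs_re_mul_conj_le ((hKW z).trans ?_) ((hKW' z).trans ?_) <;> gcongr <;> linarith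
    have hE := hpos z
    rw [Real.norm_eq_abs, abs_div, abs_of_pos (by positivity : 0 < energy p q z ^ 2 * _),
      div_le_iff₀ (by positivity)]
    calc |(W.eval z * conj (W'.eval z)).re| ≤ (K + K') * ((1 + ‖z‖ ^ 2) ^ n) ^ 2 := hre
      _ = (K + K') / ε ^ 2 * (ε * (1 + ‖z‖ ^ 2) ^ n) ^ 2 := by field_simp
      _ ≤ (K + K') / ε ^ 2 * energy p q z ^ 2 := by gcongr; exact hle z
      _ = (K + K') / ε ^ 2 * ((1 + ‖z‖ ^ 2) ^ 2)⁻¹ *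
          (energy p q z ^ 2 * (1 + ‖z‖ ^ 2) ^ 2) := by field_simp

end Density

section Deformation

/-- The numerator of the derivative `(p' q - p q') / q²` at `t = 0` of the family
`(p + t p') / (q + t q')` of rational maps. -/
def deformNum (p q p' q' : ℂ[X]) : ℂ[X] := p' * q - p * q'

lemma natDegree_deformNum_le {p q p' q' : ℂ[X]} {n : ℕ} (hp : p.natDegree ≤ n)
    (hq : q.natDegree ≤ n) (hp' : p'.natDegree ≤ n) (hq' : q'.natDegree ≤ n) :
    (deformNum p q p' q').natDegree ≤ 2 * n := by
  rw [two_mul]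
  exact (natDegree_sub_le_of_le (natDegree_mul_le_of_le hp' hq)
    (natDegree_mul_le_of_le hp hq')).trans_eq (max_self _)

lemma norm_eval_deformNum_sq_le (p q p' q' : ℂ[X]) (z : ℂ) :
    ‖(deformNum p q p' q').eval z‖ ^ 2 ≤ energy p' q' z * energy p q z := by
  have htri : ‖(deformNum p q p' q').eval z‖ ≤
      ‖p'.eval z‖ * ‖q.eval z‖ + ‖p.eval z‖ * ‖q'.eval z‖ := by
    rw [deformNum, eval_sub, eval_mul, eval_mul, ← norm_mul, ← norm_mul]
    exact norm_sub_le _ _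
  calc ‖(deformNum p q p' q').eval z‖ ^ 2
      ≤ (‖p'.eval z‖ * ‖q.eval z‖ + ‖p.eval z‖ * ‖q'.eval z‖) ^ 2 := by gcongr
    _ ≤ energy p' q' z * energy p q z := by
        unfold energy
        nlinarith [sq_nonneg (‖p'.eval z‖ * ‖p.eval z‖ - ‖q.eval z‖ * ‖q'.eval z‖)]

lemma hasDerivAt_affine_ratMap_add (p q p' q' : ℂ[X]) {z : ℂ} (hz : q.eval z ≠ 0) :
    HasDerivAt (fun t : ℝ => affine (ratMap (p + C (t : ℂ) * p') (q + C (t : ℂ) * q')) z)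
      ((deformNum p q p' q').eval z / q.eval z ^ 2) 0 := by
  have hlin (r r' : ℂ[X]) :
      HasDerivAt (fun t : ℝ => (r + C (t : ℂ) * r').eval z) (r'.eval z) 0 := by
    simpa using ((Complex.ofRealCLM.hasDerivAt (x := 0)).mul_const (r'.eval z)).const_add
      (r.eval z)
  simp only [affine_ratMap]
  refine ((hlin p p').fun_div (hlin q q') (by simpa using hz)).congr_deriv ?_
  simp [deformNum]

end Deformation

section Chart

/-- The coefficient vector of the `k`-th coordinate direction of the `j`-th affine chart. -/
def lumpDir (j : Fin 8) (k : Fin 7) : Fin 4 → ℂ :=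
  coeffs (Pi.single (j.succAbove k) 1)

lemma coeffs_add_smul (x y : Fin 8 → ℝ) (t : ℝ) :
    coeffs (x + t • y) = coeffs x + (t : ℂ) • coeffs y := by
  funext k
  apply Complex.ext <;> simp [coeffs]

lemma lumpCoeffs_add_smul_single (j : Fin 8) (y : Fin 7 → ℝ) (k : Fin 7) (t : ℝ) :
    lumpCoeffs j (y + t • Pi.single k 1) = lumpCoeffs j y + (t : ℂ) • lumpDir j k := by
  rw [lumpDir, lumpCoeffs, lumpCoeffs, ← coeffs_add_smul]
  congr 1
  rw [Fin.insertNth_eq_iff]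
  constructor
  · simp [(Fin.succAbove_ne j k).symm]
  · funext i
    simp [Fin.removeNth, Pi.single_apply]

lemma num_add_smul (a b : Fin 4 → ℂ) (t : ℂ) : num (a + t • b) = num a + C t * num b := by
  simp [num, add_mul, mul_assoc, Finset.sum_add_distrib, Finset.mul_sum]

lemma den_add_ofReal_smul (a b : Fin 4 → ℂ) (t : ℝ) :
    den (a + (t : ℂ) • b) = den a + C (t : ℂ) * den b := by
  rw [den_eq, den_eq, den_eq, ← num_add_smul]
  congr 1
  funext k
  fin_cases k <;> simp [add_comm]

lemma den_natDegree (a : Fin 4 → ℂ) : (den a).natDegree ≤ 3 := by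
  rw [den_eq]
  exact num_natDegree _

lemma partialField_lumpChart (j : Fin 8) (y : Fin 7 → ℝ) (k : Fin 7) {z : ℂ}
    (hz : (den (lumpCoeffs j y)).eval z ≠ 0) :
    partialField (lumpChart j) y k z =
      (deformNum (num (lumpCoeffs j y)) (den (lumpCoeffs j y)) (num (lumpDir j k))
        (den (lumpDir j k))).eval z / (den (lumpCoeffs j y)).eval z ^ 2 := by
  simp only [partialField, lineDeriv, lumpChart, lumpCoeffs_add_smul_single, num_add_smul,
    den_add_ofReal_smul]
  exact (hasDerivAt_affine_ratMap_add _ _ _ _ hz).deriv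

theorem integrable_l2Density_lumpChart {j : Fin 8} {y : Fin 7 → ℝ} (hy : y ∈ lumpDom j)
    (k l : Fin 7) : Integrable (l2Density (lumpChart j y) (partialField (lumpChart j) y k)
      (partialField (lumpChart j) y l)) := by
  have hdeg (k : Fin 7) := natDegree_deformNum_le (num_natDegree (lumpCoeffs j y))
    (den_natDegree (lumpCoeffs j y)) (num_natDegree (lumpDir j k)) (den_natDegree (lumpDir j k))
  refine integrable_l2Density_ratMap hy.2 (den_ne_zero hy.2) ?_ ?_
    (fun z hz => partialField_lumpChart j y k hz) fun z hz => partialField_lumpChart j y l hz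
  · rw [max_natDegree hy.2]
    exact hdeg k
  · rw [max_natDegree hy.2]
    exact hdeg l

lemma exists_enorm_l2Gram_lumpChart_le (j : Fin 8) : ∃ K : ℝ, 0 ≤ K ∧ ∀ y ∈ lumpDom j, ∀ k l,
    ‖l2Gram (lumpChart j) y k l‖ₑ ≤ ∫⁻ z : ℂ, ENNReal.ofReal
      (K * ((1 + ‖z‖ ^ 2) / energy (num (lumpCoeffs j y)) (den (lumpCoeffs j y)) z)) := by
  choose B hB using fun k =>
    exists_energy_le (num_natDegree (lumpDir j k)) (den_natDegree (lumpDir j k))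
  obtain ⟨K, hK⟩ := Finite.exists_le B
  refine ⟨|K|, abs_nonneg K, fun y hy k l => ?_⟩
  refine (enorm_integral_le_lintegral_enorm _).trans (lintegral_mono_ae ?_)
  filter_upwards [ae_eval_ne_zero (den_ne_zero hy.2)] with z hz
  have hE := energy_pos hy.2 z
  set E := energy (num (lumpCoeffs j y)) (den (lumpCoeffs j y)) z
  have hW (k : Fin 7) : ‖(deformNum (num (lumpCoeffs j y)) (den (lumpCoeffs j y))
      (num (lumpDir j k)) (den (lumpDir j k))).eval z‖ ^ 2 ≤ |K| * (1 + ‖z‖ ^ 2) ^ 3 * E := by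
    refine (norm_eval_deformNum_sq_le _ _ _ _ z).trans ?_
    gcongr
    refine (hB k z).trans ?_
    gcongr
    exact (hK k).trans (le_abs_self K)
  rw [lumpChart, l2Density_ratMap hz (partialField_lumpChart j y k hz)
    (partialField_lumpChart j y l hz), ← ofReal_norm, Real.norm_eq_abs, abs_div,
    abs_of_pos (by positivity : 0 < E ^ 2 * (1 + ‖z‖ ^ 2) ^ 2)]
  refine ENNReal.ofReal_le_ofReal ((div_le_iff₀ (by positivity)).2 ?_)
  refine (abs_re_mul_conj_le (hW k) (hW l)).trans_eq ?_
  field_simp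

end Chart

section Mobius

/-- The numerator of the Möbius transformation of a `2 × 2` matrix. -/
def mobiusNum (A : Matrix (Fin 2) (Fin 2) ℂ) (z : ℂ) : ℂ := A 0 0 * z + A 0 1

/-- The denominator of the Möbius transformation of a `2 × 2` matrix. -/
def mobiusDen (A : Matrix (Fin 2) (Fin 2) ℂ) (z : ℂ) : ℂ := A 1 0 * z + A 1 1

/-- The Möbius transformation of a `2 × 2` matrix on `ℂ`, with value `0` at its pole. -/
def mobius (A : Matrix (Fin 2) (Fin 2) ℂ) (z : ℂ) : ℂ := mobiusNum A z / mobiusDen A z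

variable {A : Matrix (Fin 2) (Fin 2) ℂ}

lemma hasDerivAt_mobius (A : Matrix (Fin 2) (Fin 2) ℂ) {z : ℂ} (hz : mobiusDen A z ≠ 0) :
    HasDerivAt (mobius A) (A.det / mobiusDen A z ^ 2) z := by
  have hlin (p q : ℂ) : HasDerivAt (fun z : ℂ => p * z + q) p z := by
    simpa using ((hasDerivAt_id z).const_mul p).add_const q
  refine ((hlin (A 0 0) (A 0 1)).div (hlin (A 1 0) (A 1 1)) hz).congr_deriv ?_
  rw [Matrix.det_fin_two, mobiusDen]
  ring

lemma mobiusDen_adjugate_mobius (A : Matrix (Fin 2) (Fin 2) ℂ) {z : ℂ} (hz : mobiusDen A z ≠ 0) :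
    mobiusDen A.adjugate (mobius A z) = A.det / mobiusDen A z := by
  rw [eq_div_iff hz, mobius, mobiusDen]
  simp only [Matrix.adjugate_fin_two, Matrix.of_apply, Matrix.cons_val', Matrix.cons_val_zero,
    Matrix.cons_val_one, Matrix.cons_val_fin_one]
  field_simp
  rw [Matrix.det_fin_two, mobiusNum, mobiusDen]
  ring

lemma mobius_adjugate_mobius (hA : A.det ≠ 0) {z : ℂ} (hz : mobiusDen A z ≠ 0) :
    mobius A.adjugate (mobius A z) = z := by
  rw [mobius, mobiusDen_adjugate_mobius A hz, div_div_eq_mul_div, div_eq_iff hA, mobiusNum, mobius]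
  simp only [Matrix.adjugate_fin_two, Matrix.of_apply, Matrix.cons_val', Matrix.cons_val_zero,
    Matrix.cons_val_one, Matrix.cons_val_fin_one]
  field_simp
  rw [Matrix.det_fin_two, mobiusNum, mobiusDen]
  ring

lemma det_adjugate_ne_zero (hA : A.det ≠ 0) : A.adjugate.det ≠ 0 := by
  simpa [Matrix.det_adjugate] using hA

lemma bijOn_mobius (hA : A.det ≠ 0) :
    Set.BijOn (mobius A) {z | mobiusDen A z ≠ 0} {w | mobiusDen A.adjugate w ≠ 0} := by
  have hmaps {B : Matrix (Fin 2) (Fin 2) ℂ} (hB : B.det ≠ 0) :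
      Set.MapsTo (mobius B) {z | mobiusDen B z ≠ 0} {w | mobiusDen B.adjugate w ≠ 0} := by
    intro z hz
    rw [Set.mem_ofPred_eq, mobiusDen_adjugate_mobius B hz]
    exact div_ne_zero hB hz
  have hadj : A.adjugate.adjugate = A := by simp [Matrix.adjugate_adjugate A (by simp)]
  have hA' := det_adjugate_ne_zero hA
  refine Set.InvOn.bijOn ⟨fun z hz => mobius_adjugate_mobius hA hz, fun w hw => ?_⟩ (hmaps hA) ?_
  · simpa only [hadj] using mobius_adjugate_mobius hA' hw
  · simpa only [hadj] using hmaps hA'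

lemma ae_mobiusDen_ne_zero (hA : A.det ≠ 0) : ∀ᵐ z : ℂ, mobiusDen A z ≠ 0 := by
  have hp : C (A 1 0) * X + C (A 1 1) ≠ 0 := by
    intro hp
    have h₀ : A 1 1 = 0 := by simpa using congrArg (coeff · 0) hp
    have h₁ : A 1 0 = 0 := by simpa using congrArg (coeff · 1) hp
    exact hA (by rw [Matrix.det_fin_two, h₀, h₁, mul_zero, mul_zero, sub_zero])
  simpa [mobiusDen] using ae_eval_ne_zero hp

lemma restrict_eq_self_of_ae {α : Type*} [MeasurableSpace α] {μ : Measure α} {p : α → Prop}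
    (h : ∀ᵐ x ∂μ, p x) : μ.restrict {x | p x} = μ := by
  rw [Measure.restrict_congr_set (Filter.eventuallyEq_univ.2 h), Measure.restrict_univ]

lemma abs_det_restrictScalars_toSpanSingleton (w : ℂ) :
    |((ContinuousLinearMap.toSpanSingleton ℂ w).restrictScalars ℝ).det| = ‖w‖ ^ 2 := by
  simp [ContinuousLinearMap.det, LinearMap.det_restrictScalars, Algebra.norm_complex_eq,
    Complex.normSq_eq_norm_sq]

lemma setLIntegral_eq_of_bijOn_of_hasDerivAt {f f' : ℂ → ℂ} {S T : Set ℂ} (hS : MeasurableSet S)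
    (hf : ∀ z ∈ S, HasDerivAt f (f' z) z) (hbij : Set.BijOn f S T) (g : ℂ → ENNReal) :
    ∫⁻ w in T, g w = ∫⁻ z in S, ENNReal.ofReal (‖f' z‖ ^ 2) * g (f z) := by
  rw [← hbij.image_eq, lintegral_image_eq_lintegral_abs_det_fderiv_mul volume hS
    (fun z hz => ((hf z hz).hasFDerivAt.restrictScalars ℝ).hasFDerivWithinAt) hbij.injOn g]
  simp only [abs_det_restrictScalars_toSpanSingleton]

lemma setIntegral_eq_of_bijOn_of_hasDerivAt {E : Type*} [NormedAddCommGroup E] [NormedSpace ℝ E]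
    {f f' : ℂ → ℂ} {S T : Set ℂ} (hS : MeasurableSet S) (hf : ∀ z ∈ S, HasDerivAt f (f' z) z)
    (hbij : Set.BijOn f S T) (g : ℂ → E) :
    ∫ w in T, g w = ∫ z in S, ‖f' z‖ ^ 2 • g (f z) := by
  rw [← hbij.image_eq, integral_image_eq_integral_abs_det_fderiv_smul volume hS
    (fun z hz => ((hf z hz).hasFDerivAt.restrictScalars ℝ).hasFDerivWithinAt) hbij.injOn g]
  simp only [abs_det_restrictScalars_toSpanSingleton]

lemma measurableSet_mobiusDen_ne_zero (A : Matrix (Fin 2) (Fin 2) ℂ) :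
    MeasurableSet {z | mobiusDen A z ≠ 0} := by
  unfold mobiusDen
  exact (isOpen_ne_fun (by fun_prop) (by fun_prop)).measurableSet

lemma lintegral_mobius (hA : A.det ≠ 0) (g : ℂ → ENNReal) :
    ∫⁻ w, g w = ∫⁻ z, ENNReal.ofReal (‖A.det / mobiusDen A z ^ 2‖ ^ 2) * g (mobius A z) := by
  have := setLIntegral_eq_of_bijOn_of_hasDerivAt (measurableSet_mobiusDen_ne_zero A)
    (fun z hz => hasDerivAt_mobius A hz) (bijOn_mobius hA) g
  rwa [restrict_eq_self_of_ae (ae_mobiusDen_ne_zero hA),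
    restrict_eq_self_of_ae (ae_mobiusDen_ne_zero (det_adjugate_ne_zero hA))] at this

lemma integral_mobius {E : Type*} [NormedAddCommGroup E] [NormedSpace ℝ E] (hA : A.det ≠ 0)
    (g : ℂ → E) :
    ∫ w, g w = ∫ z, ‖A.det / mobiusDen A z ^ 2‖ ^ 2 • g (mobius A z) := by
  have := setIntegral_eq_of_bijOn_of_hasDerivAt (measurableSet_mobiusDen_ne_zero A)
    (fun z hz => hasDerivAt_mobius A hz) (bijOn_mobius hA) g
  rwa [restrict_eq_self_of_ae (ae_mobiusDen_ne_zero hA),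
    restrict_eq_self_of_ae (ae_mobiusDen_ne_zero (det_adjugate_ne_zero hA))] at this

lemma lintegral_neg_inv_conj (g : ℂ → ENNReal) :
    ∫⁻ w, g w = ∫⁻ z, ENNReal.ofReal ((‖z‖ ^ 4)⁻¹) * g (-1 / conj z) := by
  have hdet : (!![0, -1; 1, 0] : Matrix (Fin 2) (Fin 2) ℂ).det = 1 := by simp
  rw [lintegral_mobius (by rw [hdet]; exact one_ne_zero) g,
    ← Complex.conjLIE.measurePreserving.lintegral_comp_emb
      Complex.conjLIE.toHomeomorph.measurableEmbedding]
  simp [mobius, mobiusNum, mobiusDen, ← pow_mul]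

end Mobius

section Inversion

lemma energy_antipode (a : Fin 4 → ℂ) {z : ℂ} (hz : z ≠ 0) :
    energy (num a) (den a) (-1 / conj z) = energy (num a) (den a) z / ‖z‖ ^ 6 := by
  have : ‖z‖ ≠ 0 := norm_ne_zero_iff.2 hz
  rw [energy, num_antipode a hz, den_antipode a hz]
  simp only [map_div₀, map_neg, map_pow, norm_div, norm_neg, norm_pow, RCLike.norm_conj, energy]
  field_simp
  ring

lemma setLIntegral_compl_closedBall_le (a : Fin 4 → ℂ) (K : ℝ) :
    ∫⁻ z in (Metric.closedBall (0 : ℂ) 1)ᶜ,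
        ENNReal.ofReal (K * ((1 + ‖z‖ ^ 2) / energy (num a) (den a) z)) ≤
      ∫⁻ z in Metric.closedBall (0 : ℂ) 1,
        ENNReal.ofReal (K * ((1 + ‖z‖ ^ 2) / energy (num a) (den a) z)) := by
  rw [← lintegral_indicator measurableSet_closedBall.compl,
    ← lintegral_indicator measurableSet_closedBall, lintegral_neg_inv_conj]
  refine lintegral_mono_ae ?_
  filter_upwards [compl_mem_ae_iff.2 (measure_singleton (0 : ℂ))] with z hz
  have hz0 : 0 < ‖z‖ := norm_pos_iff.2 hz
  classical
  rw [Set.indicator_apply, Set.indicator_apply]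
  simp only [Set.mem_compl_iff, mem_closedBall_zero_iff, norm_div, norm_neg, norm_one,
    RCLike.norm_conj, not_le, one_lt_div hz0]
  split_ifs with hlt hle hle
  · rw [← ENNReal.ofReal_mul (by positivity), energy_antipode a hz]
    refine ENNReal.ofReal_le_ofReal (le_of_eq ?_)
    field_simp
    ring
  · exact absurd hlt.le hle
  · simp
  · simp

lemma lintegral_le_setLIntegral_closedBall (a : Fin 4 → ℂ) {K : ℝ} (hK : 0 ≤ K) :
    ∫⁻ z, ENNReal.ofReal (K * ((1 + ‖z‖ ^ 2) / energy (num a) (den a) z)) ≤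
      ENNReal.ofReal (4 * K) *
        ∫⁻ z in Metric.closedBall (0 : ℂ) 1, ENNReal.ofReal (energy (num a) (den a) z)⁻¹ := by
  set D := Metric.closedBall (0 : ℂ) 1
  set F : ℂ → ENNReal :=
    fun z => ENNReal.ofReal (K * ((1 + ‖z‖ ^ 2) / energy (num a) (den a) z))
  have hdisc : ∫⁻ z in D, F z ≤ ENNReal.ofReal (2 * K) *
      ∫⁻ z in D, ENNReal.ofReal (energy (num a) (den a) z)⁻¹ := by
    rw [← lintegral_const_mul' _ _ ENNReal.ofReal_ne_top]
    refine setLIntegral_mono' measurableSet_closedBall fun z hz => ?_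
    have hz1 : ‖z‖ ^ 2 ≤ 1 := pow_le_one₀ (norm_nonneg z) (mem_closedBall_zero_iff.1 hz)
    rw [← ENNReal.ofReal_mul (by positivity)]
    refine ENNReal.ofReal_le_ofReal ?_
    have := energy_nonneg (num a) (den a) z
    calc K * ((1 + ‖z‖ ^ 2) / energy (num a) (den a) z)
        ≤ K * ((1 + 1) / energy (num a) (den a) z) := by gcongr
      _ = 2 * K * (energy (num a) (den a) z)⁻¹ := by ring
  calc ∫⁻ z, F z = (∫⁻ z in D, F z) + ∫⁻ z in Dᶜ, F z :=
        (lintegral_add_compl F measurableSet_closedBall).symm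
    _ ≤ (∫⁻ z in D, F z) + ∫⁻ z in D, F z :=
        add_le_add le_rfl (setLIntegral_compl_closedBall_le a K)
    _ ≤ _ := add_le_add hdisc hdisc
    _ = _ := by
        rw [← add_mul, ← ENNReal.ofReal_add (by positivity) (by positivity)]
        ring_nf

end Inversion

section CommonRoots

lemma eval_derivative_num (a : Fin 4 → ℂ) (z : ℂ) :
    (derivative (num a)).eval z = a 1 + 2 * a 2 * z + 3 * a 3 * z ^ 2 := by
  simp only [num, Fin.sum_univ_four, Fin.isValue, Fin.coe_ofNat_eq_mod, Nat.zero_mod, pow_zero,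
    mul_one, Nat.one_mod, pow_one, Nat.reduceMod, Nat.mod_succ, derivative_C,
    derivative_mul, zero_mul, derivative_X, zero_add, derivative_X_pow_succ, Nat.cast_one, map_add,
    map_one, Nat.cast_ofNat, eval_add, eval_C, eval_mul, eval_one, eval_X, eval_pow]
  ring

lemma eval_derivative_den (a : Fin 4 → ℂ) (z : ℂ) :
    (derivative (den a)).eval z = -conj (a 2) + 2 * conj (a 1) * z - 3 * conj (a 0) * z ^ 2 := by
  rw [den_eq, eval_derivative_num]
  simp only [Fin.isValue, Matrix.cons_val_one, Matrix.cons_val_zero, Matrix.cons_val, mul_neg,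
    neg_mul]
  ring

lemma one_add_mul_conj_ne_zero (z : ℂ) : 1 + z * conj z ≠ 0 := by
  rw [Complex.mul_conj]
  exact_mod_cast (add_pos_of_pos_of_nonneg one_pos (Complex.normSq_nonneg z)).ne'

lemma eq_zero_of_common_double_root {a : Fin 4 → ℂ} {z : ℂ} (hnum : (num a).eval z = 0)
    (hnum' : (derivative (num a)).eval z = 0) (hden : (den a).eval z = 0)
    (hden' : (derivative (den a)).eval z = 0) : a = 0 := by
  rw [num_eval] at hnum
  rw [eval_derivative_num] at hnum'
  replace hden := congrArg conj hden
  replace hden' := congrArg conj hden'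
  rw [den_eval] at hden
  rw [eval_derivative_den] at hden'
  simp only [map_add, map_sub, map_mul, map_neg, map_pow, Complex.conj_conj, map_zero,
    map_ofNat] at hden hden'
  have hz : (1 + z * conj z) ^ 2 ≠ 0 := pow_ne_zero 2 (one_add_mul_conj_ne_zero z)
  set u := conj z
  -- Writing `num a = (X - z) ^ 2 * (a 3 * X + b)`, the double root of the denominator forces
  -- `(1 + z * conj z) ^ 2 * b = 0`.
  obtain ⟨b, hb⟩ : ∃ b, b = a 2 + 2 * z * a 3 := ⟨_, rfl⟩
  have ha₂ : a 2 = b - 2 * z * a 3 := by rw [hb]; ring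
  have ha₁ : a 1 = z ^ 2 * a 3 - 2 * z * b := by rw [ha₂] at hnum'; linear_combination hnum'
  have ha₀ : a 0 = z ^ 2 * b := by rw [ha₁, ha₂] at hnum; linear_combination hnum
  rw [ha₂, ha₁, ha₀] at hden hden'
  have ha₃ : a 3 = u * b := by
    have : (1 + z * u) ^ 2 * (a 3 - u * b) = 0 := by linear_combination hden
    exact sub_eq_zero.1 ((mul_eq_zero.1 this).resolve_left hz)
  have hb₀ : b = 0 := by
    rw [ha₃] at hden'
    have : (1 + z * u) ^ 2 * b = 0 := by linear_combination -hden'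
    exact (mul_eq_zero.1 this).resolve_left hz
  funext k
  fin_cases k <;> simp [ha₀, ha₁, ha₂, ha₃, hb₀]

lemma energy_comm (p q : ℂ[X]) (z : ℂ) : energy p q z = energy q p z := add_comm _ _

lemma ofReal_energy_rpow_neg_le (p q : ℂ[X]) {s : ℝ} (hs : 0 ≤ s) (z : ℂ) :
    ENNReal.ofReal (energy p q z) ^ (-s) ≤ ‖p.eval z‖ₑ ^ (-(2 * s)) := by
  have hle : ‖p.eval z‖ₑ ^ (2 : ℝ) ≤ ENNReal.ofReal (energy p q z) := by
    rw [← ofReal_norm, ENNReal.ofReal_rpow_of_nonneg (norm_nonneg _) zero_le_two]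
    refine ENNReal.ofReal_le_ofReal ?_
    rw [Real.rpow_two, energy]
    exact le_add_of_nonneg_right (sq_nonneg _)
  rw [← mul_neg, ENNReal.rpow_mul]
  exact rpow_neg_le_rpow_neg hs hle

lemma exists_nhds_setLIntegral_energy_rpow_neg_le {X : Type*} [TopologicalSpace X]
    {p q : X → ℂ[X]} {x₀ : X} {z₀ : ℂ}
    (hp : ContinuousAt (fun x : X × ℂ => (p x.1).eval x.2) (x₀, z₀))
    (hp' : ContinuousAt (fun x : X × ℂ => (derivative (p x.1)).eval x.2) (x₀, z₀))
    (h0 : (p x₀).eval z₀ ≠ 0 ∨ (derivative (p x₀)).eval z₀ ≠ 0) {s : ℝ} (hs0 : 0 ≤ s)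
    (hs : s < 1) :
    ∃ U ∈ nhds x₀, ∃ V ∈ nhds z₀, ∃ C ≠ ⊤, ∀ x ∈ U,
      ∫⁻ z in V, ENNReal.ofReal (energy (p x) (q x) z) ^ (-s) ≤ C := by
  have hα : 2 * s < Module.finrank ℝ ℂ := by
    rw [Complex.finrank_real_complex]
    push_cast
    linarith
  obtain ⟨U, hU, V, hV, C, hC, hle⟩ := exists_nhds_setLIntegral_enorm_rpow_neg_le volume
    (fun x z => (p x).hasDerivAt z) hp hp' h0 (by positivity) hα
  exact ⟨U, hU, V, hV, C, hC, fun x hx =>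
    (lintegral_mono fun z => ofReal_energy_rpow_neg_le _ _ hs0 z).trans (hle x hx)⟩

theorem exists_setLIntegral_energy_rpow_neg_le {K : Set (Fin 4 → ℂ)} (hK : IsCompact K)
    (h0 : 0 ∉ K) {s : ℝ} (hs0 : 0 ≤ s) (hs : s < 1) :
    ∃ C ≠ ⊤, ∀ a ∈ K,
      ∫⁻ z in Metric.closedBall 0 1, ENNReal.ofReal (energy (num a) (den a) z) ^ (-s) ≤ C := by
  refine exists_setLIntegral_le_of_isCompact volume hK (isCompact_closedBall 0 1)
    fun a ha z _ => ?_
  by_cases hnum : (num a).eval z ≠ 0 ∨ (derivative (num a)).eval z ≠ 0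
  · refine exists_nhds_setLIntegral_energy_rpow_neg_le ?_ ?_ hnum hs0 hs
    · simp only [num_eval]
      fun_prop
    · simp only [eval_derivative_num]
      fun_prop
  · have hden : (den a).eval z ≠ 0 ∨ (derivative (den a)).eval z ≠ 0 := by
      by_contra! hden
      push Not at hnum
      exact h0 (eq_zero_of_common_double_root hnum.1 hnum.2 hden.1 hden.2 ▸ ha)
    simp only [fun a => energy_comm (num a) (den a)]
    refine exists_nhds_setLIntegral_energy_rpow_neg_le ?_ ?_ hden hs0 hs
    · simp only [den_eval]
      fun_prop
    · simp only [eval_derivative_den]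
      fun_prop

end CommonRoots

section Resultant

open Matrix

lemma sum_sylvester_index {R : Type*} [CommRing R] {f : R[X]} {m : ℕ} (hf : f.natDegree ≤ m)
    {N j : ℕ} (hj : j + m < N) (z : R) :
    ∑ i : Fin N, z ^ (i : ℕ) * (if (i : ℕ) ∈ Set.Icc j (j + m) then f.coeff (i - j) else 0) =
      z ^ j * f.eval z := by
  rw [Fin.sum_univ_eq_sum_range
    fun i => z ^ i * (if i ∈ Set.Icc j (j + m) then f.coeff (i - j) else 0)]
  simp only [mul_ite, mul_zero, Set.mem_Icc]
  rw [← Finset.sum_filter]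
  rw [eval_eq_sum_range' (Nat.lt_succ_of_le hf), Finset.mul_sum]
  refine Finset.sum_nbij' (· - j) (· + j) ?_ ?_ ?_ ?_ ?_
  all_goals simp only [Finset.mem_filter, Finset.mem_range]
  · omega
  · omega
  · omega
  · omega
  · rintro i ⟨-, hi⟩
    rw [mul_left_comm, ← pow_add, Nat.add_sub_cancel' hi.1, mul_comm]

lemma vecMul_sylvester {R : Type*} [CommRing R] {f g : R[X]} {m n : ℕ} (hf : f.natDegree ≤ m)
    (hg : g.natDegree ≤ n) (z : R) :
    (fun i : Fin (m + n) => z ^ (i : ℕ)) ᵥ* sylvester f g m n =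
      Fin.addCases (fun j : Fin m => z ^ (j : ℕ) * g.eval z)
        (fun j : Fin n => z ^ (j : ℕ) * f.eval z) := by
  funext j
  refine j.addCases (fun j => ?_) (fun j => ?_)
  · simp only [vecMul, dotProduct, sylvester, of_apply, Fin.addCases_left]
    exact sum_sylvester_index hg (by omega) z
  · simp only [vecMul, dotProduct, sylvester, of_apply, Fin.addCases_right]
    exact sum_sylvester_index hf (by omega) z

lemma norm_vecMul_sylvester_le {f g : ℂ[X]} {m n : ℕ} (hf : f.natDegree ≤ m)
    (hg : g.natDegree ≤ n) {z : ℂ} (hz : ‖z‖ ≤ 1) (j : Fin (m + n)) :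
    ‖((fun i : Fin (m + n) => z ^ (i : ℕ)) ᵥ* sylvester f g m n) j‖ ^ 2 ≤ energy f g z := by
  have hle (w : ℂ) (k : ℕ) : ‖z ^ k * w‖ ^ 2 ≤ ‖w‖ ^ 2 := by
    rw [norm_mul, norm_pow]
    gcongr
    exact mul_le_of_le_one_left (norm_nonneg _) (pow_le_one₀ (norm_nonneg _) hz)
  rw [vecMul_sylvester hf hg, energy]
  refine j.addCases (fun j => ?_) (fun j => ?_) <;> beta_reduce
  · rw [Fin.addCases_left]
    exact (hle _ _).trans (le_add_of_nonneg_left (sq_nonneg _))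
  · rw [Fin.addCases_right]
    exact (hle _ _).trans (le_add_of_nonneg_right (sq_nonneg _))

lemma norm_resultant_sq_le {f g : ℂ[X]} {m n : ℕ} [NeZero (m + n)] (hf : f.natDegree ≤ m)
    (hg : g.natDegree ≤ n) {z : ℂ} (hz : ‖z‖ ≤ 1) :
    ‖resultant f g m n‖ ^ 2 ≤
      (∑ j, ‖(sylvester f g m n).adjugate j 0‖) ^ 2 * energy f g z := by
  set S := sylvester f g m n
  set v : Fin (m + n) → ℂ := fun i => z ^ (i : ℕ)
  have hres : resultant f g m n = ∑ j, (v ᵥ* S) j * S.adjugate j 0 := by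
    have := congrFun (vecMul_vecMul v S S.adjugate) 0
    rw [mul_adjugate, vecMul_smul, vecMul_one] at this
    simpa [v, vecMul, dotProduct, resultant] using this.symm
  have hle : ‖resultant f g m n‖ ≤ (∑ j, ‖S.adjugate j 0‖) * √(energy f g z) := by
    rw [hres, Finset.sum_mul]
    refine norm_sum_le_of_le _ fun j _ => ?_
    rw [norm_mul, mul_comm]
    gcongr
    exact Real.le_sqrt_of_sq_le (norm_vecMul_sylvester_le hf hg hz j)
  calc ‖resultant f g m n‖ ^ 2 ≤ ((∑ j, ‖S.adjugate j 0‖) * √(energy f g z)) ^ 2 := by gcongr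
    _ = _ := by rw [mul_pow, Real.sq_sqrt (energy_nonneg f g z)]

lemma continuous_sylvester {X : Type*} [TopologicalSpace X] {R : Type*} [Semiring R]
    [TopologicalSpace R] {f g : X → R[X]} (hf : ∀ k, Continuous fun x => (f x).coeff k)
    (hg : ∀ k, Continuous fun x => (g x).coeff k) (m n : ℕ) :
    Continuous fun x => sylvester (f x) (g x) m n := by
  refine continuous_matrix fun i j => ?_
  refine j.addCases (fun j => ?_) (fun j => ?_)
  · simp only [sylvester, of_apply, Fin.addCases_left]
    exact continuous_if_const _ (fun _ => hg _) (fun _ => continuous_const)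
  · simp only [sylvester, of_apply, Fin.addCases_right]
    exact continuous_if_const _ (fun _ => hf _) (fun _ => continuous_const)

lemma sylvester_add_C_mul {R : Type*} [Semiring R] (f g f' g' : R[X]) (m n : ℕ) (t : R) :
    sylvester (f + C t * f') (g + C t * g') m n =
      sylvester f g m n + t • sylvester f' g' m n := by
  ext i j
  refine j.addCases (fun j => ?_) (fun j => ?_) <;>
  · simp only [sylvester, of_apply, Fin.addCases_left, Fin.addCases_right, Matrix.add_apply,
      Matrix.smul_apply]
    split_ifs <;> simp

lemma continuous_coeff_num (k : ℕ) : Continuous fun a => (num a).coeff k := by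
  simp only [num, finsetSum_coeff, coeff_C_mul]
  fun_prop

lemma continuous_coeff_den (k : ℕ) : Continuous fun a => (den a).coeff k := by
  simp only [den, finsetSum_coeff, coeff_C_mul]
  fun_prop

lemma exists_norm_resultant_sq_le_mul_energy {K : Set (Fin 4 → ℂ)} (hK : IsCompact K) :
    ∃ B : ℝ, 0 < B ∧ ∀ a ∈ K, ∀ z ∈ Metric.closedBall (0 : ℂ) 1,
      ‖resultant (num a) (den a) 3 3‖ ^ 2 ≤ B * energy (num a) (den a) z := by
  have hcont : Continuous fun a =>
      (∑ j, ‖(sylvester (num a) (den a) 3 3).adjugate j 0‖) ^ 2 := by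
    have := (continuous_sylvester continuous_coeff_num continuous_coeff_den 3 3).matrix_adjugate
    exact (continuous_finsetSum _ fun j _ => (this.matrix_elem j 0).norm).pow 2
  obtain ⟨B, hB⟩ := (hK.image hcont).bddAbove
  refine ⟨max B 1, by positivity, fun a ha z hz => ?_⟩
  refine (norm_resultant_sq_le (num_natDegree a) (den_natDegree a)
    (mem_closedBall_zero_iff.1 hz)).trans ?_
  gcongr
  · exact energy_nonneg _ _ z
  · exact (hB (Set.mem_image_of_mem _ ha)).trans (le_max_left B 1)

lemma inv_le_rpow_mul_rpow_neg {r B x θ : ℝ} (hr : 0 < r) (hB : 0 < B) (h : r ≤ B * x)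
    (hθ : 0 ≤ θ) : x⁻¹ ≤ B ^ θ * r ^ (-θ) * x ^ (-(1 - θ)) := by
  have hx : 0 < x := pos_of_mul_pos_right (hr.trans_le h) hB.le
  calc x⁻¹ = B ^ θ * (B * x) ^ (-θ) * x ^ (-(1 - θ)) := by
        rw [Real.mul_rpow hB.le hx.le, ← mul_assoc, ← Real.rpow_add hB, mul_assoc,
          ← Real.rpow_add hx, add_neg_cancel, Real.rpow_zero, one_mul, ← Real.rpow_neg_one]
        ring_nf
    _ ≤ B ^ θ * r ^ (-θ) * x ^ (-(1 - θ)) := by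
        gcongr ?_ * ?_ * ?_
        exact Real.rpow_le_rpow_of_nonpos hr h (neg_nonpos.2 hθ)

theorem exists_setLIntegral_inv_energy_le {K : Set (Fin 4 → ℂ)} (hK : IsCompact K) (h0 : 0 ∉ K)
    {θ : ℝ} (hθ0 : 0 < θ) (hθ1 : θ ≤ 1) :
    ∃ C ≠ ⊤, ∀ a ∈ K, resultant (num a) (den a) 3 3 ≠ 0 →
      ∫⁻ z in Metric.closedBall 0 1, ENNReal.ofReal (energy (num a) (den a) z)⁻¹ ≤
        C * ‖resultant (num a) (den a) 3 3‖ₑ ^ (-(2 * θ)) := by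
  obtain ⟨B, hB0, hB⟩ := exists_norm_resultant_sq_le_mul_energy hK
  obtain ⟨C, hC, hle⟩ := exists_setLIntegral_energy_rpow_neg_le hK h0 (sub_nonneg.2 hθ1)
    (sub_lt_self 1 hθ0)
  refine ⟨ENNReal.ofReal (B ^ θ) * C, ENNReal.mul_ne_top ENNReal.ofReal_ne_top hC,
    fun a ha hres => ?_⟩
  set r := resultant (num a) (den a) 3 3
  have hr : 0 < ‖r‖ := norm_pos_iff.2 hres
  have hpow : ENNReal.ofReal ((‖r‖ ^ 2) ^ (-θ)) = ‖r‖ₑ ^ (-(2 * θ)) := by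
    rw [← Real.rpow_natCast, ← Real.rpow_mul hr.le, ← ENNReal.ofReal_rpow_of_pos hr, ofReal_norm,
      Nat.cast_ofNat, mul_neg]
  have hpt (z : ℂ) (hz : z ∈ Metric.closedBall (0 : ℂ) 1) :
      ENNReal.ofReal (energy (num a) (den a) z)⁻¹ ≤ ENNReal.ofReal (B ^ θ) * ‖r‖ₑ ^ (-(2 * θ)) *
        ENNReal.ofReal (energy (num a) (den a) z) ^ (-(1 - θ)) := by
    have hE : 0 < energy (num a) (den a) z :=
      pos_of_mul_pos_right ((pow_pos hr 2).trans_le (hB a ha z hz)) hB0.le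
    rw [← hpow, ENNReal.ofReal_rpow_of_pos hE, ← ENNReal.ofReal_mul (by positivity),
      ← ENNReal.ofReal_mul (by positivity)]
    exact ENNReal.ofReal_le_ofReal
      (inv_le_rpow_mul_rpow_neg (pow_pos hr 2) hB0 (hB a ha z hz) hθ0.le)
  calc ∫⁻ z in Metric.closedBall 0 1, ENNReal.ofReal (energy (num a) (den a) z)⁻¹
      ≤ ∫⁻ z in Metric.closedBall 0 1, ENNReal.ofReal (B ^ θ) * ‖r‖ₑ ^ (-(2 * θ)) *
          ENNReal.ofReal (energy (num a) (den a) z) ^ (-(1 - θ)) :=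
        setLIntegral_mono' measurableSet_closedBall hpt
    _ ≤ ENNReal.ofReal (B ^ θ) * ‖r‖ₑ ^ (-(2 * θ)) * C := by
        rw [lintegral_const_mul' _ _ (by simp [ENNReal.mul_eq_top, ENNReal.rpow_eq_top_iff, hres])]
        gcongr
        exact hle a ha
    _ = _ := by ring

end Resultant

section Pencil

open Matrix

lemma exists_setLIntegral_enorm_ofReal_sub_rpow_neg_le {s : ℝ} (hs0 : 0 ≤ s) (hs1 : s < 1)
    (t₀ : ℝ) {r : ℝ} (hr : 0 ≤ r) :
    ∃ C : ENNReal, C ≠ ⊤ ∧ ∀ x : ℂ,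
      ∫⁻ t in Metric.closedBall t₀ r, ‖(t : ℂ) - x‖ₑ ^ (-s) ≤ C := by
  have hfin := lintegral_ball_enorm_rpow_neg_lt_top (volume : Measure ℝ) (by simp) (α := s)
    (by simpa using hs1) (2 * r + 1)
  refine ⟨_, ENNReal.mul_ne_top ?_ hfin.ne, fun x =>
    setLIntegral_enorm_rpow_neg_le volume hr one_pos (by fun_prop) (fun z _ w _ => ?_) hs0⟩
  · exact ENNReal.rpow_ne_top_of_ne_zero (by simp) ENNReal.ofReal_ne_top
  · rw [one_mul, sub_sub_sub_cancel_right, ← Complex.ofReal_sub, Complex.norm_real, dist_eq_norm]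

lemma exists_mem_roots_nnnorm_sub_pow_le {K : Type*} [NormedField K] {p : K[X]} (hp : p.Monic)
    (hs : p.Splits) (hdeg : p.natDegree ≠ 0) (z : K) :
    ∃ r ∈ p.roots, ‖z - r‖₊ ^ p.natDegree ≤ ‖p.eval z‖₊ := by
  classical
  have hne : p.roots.toFinset.Nonempty := by
    rwa [Multiset.toFinset_nonempty, ← Multiset.card_pos, ← hs.natDegree_eq_card_roots,
      Nat.pos_iff_ne_zero]
  obtain ⟨r, hr, hmin⟩ := p.roots.toFinset.exists_min_image (fun x => ‖z - x‖₊) hne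
  refine ⟨r, Multiset.mem_toFinset.1 hr, ?_⟩
  calc ‖z - r‖₊ ^ p.natDegree = ‖z - r‖₊ ^ (p.roots.map fun x => ‖z - x‖₊).card := by
        rw [Multiset.card_map, hs.natDegree_eq_card_roots]
    _ ≤ (p.roots.map fun x => ‖z - x‖₊).prod :=
        Multiset.pow_card_le_prod <| Multiset.forall_mem_map_iff.2 fun x hx =>
          hmin x (Multiset.mem_toFinset.2 hx)
    _ = ‖p.eval z‖₊ := by
        rw [hs.eval_eq_prod_roots_of_monic hp]
        exact (Multiset.prod_hom' p.roots (nnnormHom (α := K)) fun x => z - x)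

lemma exists_setLIntegral_enorm_eval_rpow_neg_le {n : ℕ} (hn : n ≠ 0) {s : ℝ} (hs0 : 0 ≤ s)
    (hs1 : n * s < 1) (t₀ : ℝ) {r : ℝ} (hr : 0 ≤ r) :
    ∃ C : ENNReal, C ≠ ⊤ ∧ ∀ p : ℂ[X], p.Monic → p.natDegree = n →
      ∫⁻ t in Metric.closedBall t₀ r, ‖p.eval (t : ℂ)‖ₑ ^ (-s) ≤ C := by
  classical
  obtain ⟨C, hC, hle⟩ :=
    exists_setLIntegral_enorm_ofReal_sub_rpow_neg_le (by positivity) hs1 t₀ hr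
  refine ⟨n * C, ENNReal.mul_ne_top (by simp) hC, fun p hp hdeg => ?_⟩
  have hsplit : p.Splits := IsAlgClosed.splits p
  have hcard : (p.roots.toFinset.card : ENNReal) ≤ n := by
    rw [← hdeg, hsplit.natDegree_eq_card_roots]
    exact_mod_cast Multiset.toFinset_card_le _
  calc ∫⁻ t in Metric.closedBall t₀ r, ‖p.eval (t : ℂ)‖ₑ ^ (-s)
      ≤ ∫⁻ t in Metric.closedBall t₀ r,
          ∑ x ∈ p.roots.toFinset, ‖(t : ℂ) - x‖ₑ ^ (-(n * s)) := lintegral_mono fun t => by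
        obtain ⟨x, hx, hxle⟩ :=
          exists_mem_roots_nnnorm_sub_pow_le hp hsplit (hdeg ▸ hn) (t : ℂ)
        calc ‖p.eval (t : ℂ)‖ₑ ^ (-s) ≤ (‖(t : ℂ) - x‖ₑ ^ n) ^ (-s) :=
              rpow_neg_le_rpow_neg hs0 (by
                rw [← hdeg, enorm_eq_nnnorm, enorm_eq_nnnorm]; exact_mod_cast hxle)
          _ = ‖(t : ℂ) - x‖ₑ ^ (-(n * s)) := by
              rw [← ENNReal.rpow_natCast, ← ENNReal.rpow_mul, mul_neg]
          _ ≤ _ := Finset.single_le_sum (f := fun x => ‖(t : ℂ) - x‖ₑ ^ (-(n * s)))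
              (fun _ _ => zero_le) (Multiset.mem_toFinset.2 hx)
    _ = ∑ x ∈ p.roots.toFinset, ∫⁻ t in Metric.closedBall t₀ r, ‖(t : ℂ) - x‖ₑ ^ (-(n * s)) :=
        lintegral_finsetSum _ fun x _ => by fun_prop
    _ ≤ ∑ _x ∈ p.roots.toFinset, C := Finset.sum_le_sum fun x _ => hle x
    _ ≤ n * C := by
        rw [Finset.sum_const, nsmul_eq_mul]
        gcongr

lemma det_add_smul_eq_mul_eval_charpoly {R ι : Type*} [CommRing R] [Fintype ι] [DecidableEq ι]
    (S : Matrix ι ι R) {D : Matrix ι ι R} (hD : IsUnit D.det) (t : R) :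
    (S + t • D).det = D.det * (-(D⁻¹ * S)).charpoly.eval t := by
  have hfactor : S + t • D = D * (Matrix.scalar ι t - -(D⁻¹ * S)) := by
    rw [sub_neg_eq_add, mul_add, ← mul_assoc, Matrix.mul_nonsing_inv _ hD, one_mul, add_comm,
      Matrix.scalar_apply, ← Matrix.smul_one_eq_diagonal, Matrix.mul_smul, mul_one]
  rw [hfactor, Matrix.det_mul, Matrix.eval_charpoly]

lemma exists_setLIntegral_enorm_det_add_smul_rpow_neg_le {n : ℕ} (hn : n ≠ 0) {s : ℝ}
    (hs0 : 0 ≤ s) (hs1 : n * s < 1) (t₀ : ℝ) {r : ℝ} (hr : 0 ≤ r)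
    {D : Matrix (Fin n) (Fin n) ℂ} (hD : D.det ≠ 0) :
    ∃ C : ENNReal, C ≠ ⊤ ∧ ∀ S : Matrix (Fin n) (Fin n) ℂ,
      ∫⁻ t in Metric.closedBall t₀ r, ‖(S + (t : ℂ) • D).det‖ₑ ^ (-s) ≤ C := by
  obtain ⟨C, hC, hle⟩ := exists_setLIntegral_enorm_eval_rpow_neg_le hn hs0 hs1 t₀ hr
  have hDtop : ‖D.det‖ₑ ^ (-s) ≠ ⊤ :=
    ENNReal.rpow_ne_top_of_ne_zero (enorm_ne_zero.2 hD) enorm_ne_top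
  refine ⟨‖D.det‖ₑ ^ (-s) * C, ENNReal.mul_ne_top hDtop hC, fun S => ?_⟩
  have hpoint (t : ℝ) : ‖(S + (t : ℂ) • D).det‖ₑ ^ (-s) =
      ‖D.det‖ₑ ^ (-s) * ‖(-(D⁻¹ * S)).charpoly.eval (t : ℂ)‖ₑ ^ (-s) := by
    rw [det_add_smul_eq_mul_eval_charpoly S hD.isUnit, enorm_mul,
      ENNReal.mul_rpow_of_ne_top enorm_ne_top enorm_ne_top]
  simp only [hpoint]
  rw [lintegral_const_mul' _ _ hDtop]
  gcongr
  exact hle _ (Matrix.charpoly_monic _) (by simp [Matrix.charpoly_natDegree_eq_dim])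

end Pencil

section Volume

lemma insertNth_eq_add_smul_single {n : ℕ} (k : Fin (n + 1)) (t : ℝ) (y : Fin n → ℝ) :
    k.insertNth (α := fun _ => ℝ) t y =
      k.insertNth (α := fun _ => ℝ) 0 y + t • Pi.single k 1 := by
  rw [Fin.insertNth_eq_iff]
  refine ⟨by simp, funext fun i => ?_⟩
  simp [Fin.removeNth, Fin.succAbove_ne]

lemma setLIntegral_pi_le_of_forall_line {n : ℕ} (k : Fin (n + 1)) {s : Set ℝ}
    (hs : MeasurableSet s) {f : (Fin (n + 1) → ℝ) → ENNReal} (hf : Measurable f) {C : ENNReal}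
    (hline : ∀ y, ∫⁻ t in s, f (y + t • Pi.single k 1) ≤ C) :
    ∫⁻ y in Set.univ.pi fun _ => s, f y ≤ C * volume s ^ n := by
  let e := (MeasurableEquiv.piFinSuccAbove (fun _ : Fin (n + 1) => ℝ) k).symm
  have hpre : e ⁻¹' (Set.univ.pi fun _ => s) = s ×ˢ Set.univ.pi fun _ => s := by
    ext ⟨t, y⟩
    simp only [e, Set.mem_preimage, MeasurableEquiv.piFinSuccAbove_symm_apply, Set.mem_univ_pi,
      Set.mem_prod, Fin.insertNthEquiv_apply]
    rw [Fin.forall_iff_succAbove k]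
    simp
  calc ∫⁻ y in Set.univ.pi fun _ => s, f y
      = ∫⁻ p in s ×ˢ Set.univ.pi fun _ => s, f (e p) := by
        rw [← hpre, (volume_preserving_piFinSuccAbove (fun _ => ℝ) k).symm
          |>.setLIntegral_comp_preimage (MeasurableSet.univ_pi fun _ => hs) hf]
    _ = ∫⁻ y in Set.univ.pi fun _ => s, ∫⁻ t in s, f (k.insertNth (α := fun _ => ℝ) t y) := by
        rw [Measure.volume_eq_prod, ← Measure.prod_restrict, lintegral_prod_symm
          (fun p => f (e p)) (hf.comp e.measurable).aemeasurable]
        rfl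
    _ ≤ ∫⁻ _y in Set.univ.pi fun _ : Fin n => s, C := lintegral_mono fun y => by
        rw [lintegral_congr fun t => congrArg f (insertNth_eq_add_smul_single k t y)]
        exact hline _
    _ = C * volume s ^ n := by
        rw [setLIntegral_const, volume_pi_pi, Finset.prod_const, Finset.card_univ,
          Fintype.card_fin]

lemma resultant_ne_zero_of_isCoprime {R : Type*} [CommRing R] [IsDomain R] {f g : R[X]}
    (h : IsCoprime f g) {n : ℕ} (hn : max f.natDegree g.natDegree = n) :
    resultant f g n n ≠ 0 := by
  wlog hfg : f.natDegree ≤ g.natDegree generalizing f g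
  · rw [resultant_comm]
    exact mul_ne_zero (pow_ne_zero _ (neg_ne_zero.2 one_ne_zero))
      (this h.symm (max_comm f.natDegree _ ▸ hn) (le_of_not_ge hfg))
  rw [max_eq_right hfg] at hn
  subst hn
  rcases hfg.eq_or_lt with heq | hlt
  · simpa only [heq] using resultant_ne_zero f g h
  · have hg : g ≠ 0 := ne_zero_of_natDegree_gt hlt
    rw [← Nat.add_sub_cancel' hfg, resultant_add_left_deg _ _ _ _ _ le_rfl,
      Nat.add_sub_cancel' hfg]
    exact mul_ne_zero (mul_ne_zero (pow_ne_zero _ (neg_ne_zero.2 one_ne_zero))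
      (pow_ne_zero _ (leadingCoeff_ne_zero.2 hg))) (resultant_ne_zero f g h)

lemma exists_isCoprime_lumpDir (j : Fin 8) :
    ∃ k, IsCoprime (num (lumpDir j k)) (den (lumpDir j k)) := by
  obtain ⟨k, hk⟩ : ∃ k, j.succAbove k = 0 ∨ j.succAbove k = 4 := by
    rcases eq_or_ne j 0 with rfl | hj
    · exact (Fin.exists_succAbove_eq (by decide : (4 : Fin 8) ≠ 0)).imp fun _ => Or.inr
    · exact (Fin.exists_succAbove_eq hj.symm).imp fun _ => Or.inl
  refine ⟨k, (isCoprime_iff _ _).2 fun z hz => ?_⟩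
  have hnum := hz.1
  rw [num_eval] at hnum
  rcases hk with hk | hk <;> simp [lumpDir, coeffs, hk, Complex.ext_iff] at hnum

lemma continuous_lumpCoeffs (j : Fin 8) : Continuous (lumpCoeffs j) := by
  have hcoord (i : Fin 8) : Continuous fun y : Fin 7 → ℝ =>
      j.insertNth (α := fun _ => ℝ) 1 y i :=
    (continuous_apply i).comp <|
      Continuous.finInsertNth (A := fun _ : Fin 8 => ℝ) j continuous_const continuous_id
  exact continuous_pi fun k => Complex.equivRealProdCLM.symm.continuous.comp
    ((hcoord (Fin.castAdd 4 k)).prodMk (hcoord (Fin.natAdd 4 k)))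

lemma lumpCoeffs_ne_zero (j : Fin 8) (y : Fin 7 → ℝ) : lumpCoeffs j y ≠ 0 := by
  intro h
  have hzero : ∀ i : Fin 8, j.insertNth (α := fun _ => ℝ) 1 y i = 0 :=
    Fin.addCases (m := 4) (n := 4) (fun k => congrArg Complex.re (congrFun h k))
      (fun k => congrArg Complex.im (congrFun h k))
  simpa using hzero j

lemma enorm_det_le {K ι : Type*} [NormedField K] [Fintype ι] [DecidableEq ι] (G : Matrix ι ι K)
    {I : ENNReal} (h : ∀ i j, ‖G i j‖ₑ ≤ I) :
    ‖G.det‖ₑ ≤ (Fintype.card ι).factorial * I ^ Fintype.card ι := by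
  have hterm (σ : Equiv.Perm ι) : ‖((σ.sign : ℤ) : K) * ∏ i, G (σ i) i‖ₑ ≤ I ^ Fintype.card ι := by
    calc ‖((σ.sign : ℤ) : K) * ∏ i, G (σ i) i‖ₑ = ∏ i, ‖G (σ i) i‖ₑ := by
          rcases Int.units_eq_one_or σ.sign with hσ | hσ <;>
          simp [hσ, enorm_eq_nnnorm, nnnorm_prod]
      _ ≤ ∏ _i, I := Finset.prod_le_prod' fun i _ => h _ _
      _ = I ^ Fintype.card ι := by rw [Finset.prod_const, Finset.card_univ]
  calc ‖G.det‖ₑ ≤ ∑ σ : Equiv.Perm ι, ‖((σ.sign : ℤ) : K) * ∏ i, G (σ i) i‖ₑ := by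
        rw [Matrix.det_apply']
        exact enorm_sum_le _ _
    _ ≤ ∑ _σ : Equiv.Perm ι, I ^ Fintype.card ι := Finset.sum_le_sum fun σ _ => hterm σ
    _ = (Fintype.card ι).factorial * I ^ Fintype.card ι := by
        rw [Finset.sum_const, Finset.card_univ, Fintype.card_perm, nsmul_eq_mul]

lemma exists_enorm_l2Gram_le_resultant (j : Fin 8) {θ : ℝ} (hθ0 : 0 < θ) (hθ1 : θ ≤ 1) :
    ∃ C : ENNReal, C ≠ ⊤ ∧ ∀ y ∈ lumpDom j, ∀ k l, ‖l2Gram (lumpChart j) y k l‖ₑ ≤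
      C * ‖resultant (num (lumpCoeffs j y)) (den (lumpCoeffs j y)) 3 3‖ₑ ^ (-(2 * θ)) := by
  have hK : IsCompact (lumpCoeffs j '' Metric.closedBall 0 2) :=
    (isCompact_closedBall 0 2).image (continuous_lumpCoeffs j)
  obtain ⟨C, hC, hle⟩ := exists_setLIntegral_inv_energy_le hK
    (fun ⟨y, _, hy⟩ => lumpCoeffs_ne_zero j y hy) hθ0 hθ1
  obtain ⟨K, hK0, hGram⟩ := exists_enorm_l2Gram_lumpChart_le j
  refine ⟨ENNReal.ofReal (4 * K) * C, ENNReal.mul_ne_top ENNReal.ofReal_ne_top hC,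
    fun y hy k l => ?_⟩
  rw [mul_assoc]
  refine (hGram y hy k l).trans ((lintegral_le_setLIntegral_closedBall _ hK0).trans ?_)
  gcongr
  refine hle _ (Set.mem_image_of_mem _ ?_)
    (resultant_ne_zero_of_isCoprime hy.2 (max_natDegree hy.2))
  exact mem_closedBall_zero_iff.2 ((pi_norm_le_iff_of_nonneg zero_le_two).2 fun k => (hy.1 k).le)

lemma exists_sqrt_det_l2Gram_le_resultant (j : Fin 8) {θ : ℝ} (hθ0 : 0 < θ) (hθ1 : θ ≤ 1) :
    ∃ C : ENNReal, C ≠ ⊤ ∧ ∀ y ∈ lumpDom j,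
      ENNReal.ofReal √|(l2Gram (lumpChart j) y).det| ≤
        C * ‖resultant (num (lumpCoeffs j y)) (den (lumpCoeffs j y)) 3 3‖ₑ ^ (-(7 * θ)) := by
  obtain ⟨C, hC, hle⟩ := exists_enorm_l2Gram_le_resultant j hθ0 hθ1
  refine ⟨(Nat.factorial 7 * C ^ 7) ^ (1 / 2 : ℝ), ENNReal.rpow_ne_top_of_nonneg (by norm_num)
    (ENNReal.mul_ne_top (by simp) (ENNReal.pow_ne_top hC)), fun y hy => ?_⟩
  set r := resultant (num (lumpCoeffs j y)) (den (lumpCoeffs j y)) 3 3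
  calc ENNReal.ofReal √|(l2Gram (lumpChart j) y).det|
      = ‖(l2Gram (lumpChart j) y).det‖ₑ ^ (1 / 2 : ℝ) := by
        rw [Real.sqrt_eq_rpow, ← ENNReal.ofReal_rpow_of_nonneg (abs_nonneg _) (by norm_num),
          ← Real.norm_eq_abs, ofReal_norm]
    _ ≤ (Nat.factorial 7 * (C * ‖r‖ₑ ^ (-(2 * θ))) ^ 7) ^ (1 / 2 : ℝ) :=
        ENNReal.rpow_le_rpow (by simpa using enorm_det_le _ (hle y hy)) (by norm_num)
    _ = (Nat.factorial 7 * C ^ 7) ^ (1 / 2 : ℝ) * ‖r‖ₑ ^ (-(7 * θ)) := by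
        rw [mul_pow, ← mul_assoc, ENNReal.mul_rpow_of_nonneg _ _ (by norm_num),
          ← ENNReal.rpow_natCast (_ ^ _), ← ENNReal.rpow_mul, ← ENNReal.rpow_mul]
        ring_nf

lemma setLIntegral_resultant_rpow_neg_lt_top (j : Fin 8) {s : ℝ} (hs0 : 0 ≤ s) (hs1 : 6 * s < 1)
    {r : ℝ} (hr : 0 ≤ r) :
    ∫⁻ y in Set.univ.pi fun _ => Metric.closedBall 0 r,
      ‖resultant (num (lumpCoeffs j y)) (den (lumpCoeffs j y)) 3 3‖ₑ ^ (-s) < ⊤ := by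
  obtain ⟨k, hk⟩ := exists_isCoprime_lumpDir j
  obtain ⟨C, hC, hle⟩ := exists_setLIntegral_enorm_det_add_smul_rpow_neg_le (n := 3 + 3)
    (by norm_num) hs0 (by norm_num; linarith) 0 hr
    (resultant_ne_zero_of_isCoprime hk (max_natDegree hk))
  have hcont : Continuous fun y => resultant (num (lumpCoeffs j y)) (den (lumpCoeffs j y)) 3 3 :=
    ((continuous_sylvester continuous_coeff_num continuous_coeff_den 3 3).comp
      (continuous_lumpCoeffs j)).matrix_det
  refine (setLIntegral_pi_le_of_forall_line k measurableSet_closedBall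
    (hcont.measurable.enorm.pow_const _) fun y => ?_).trans_lt
      (ENNReal.mul_lt_top hC.lt_top (ENNReal.pow_lt_top measure_closedBall_lt_top))
  refine (lintegral_congr fun t => ?_).trans_le
    (hle (sylvester (num (lumpCoeffs j y)) (den (lumpCoeffs j y)) 3 3))
  rw [lumpCoeffs_add_smul_single, num_add_smul, den_add_ofReal_smul, resultant,
    sylvester_add_C_mul]

theorem lumpVolume_lt_top : lumpVolume < ⊤ := by
  rw [lumpVolume, atlasVolume, ENNReal.sum_lt_top]
  intro j _
  obtain ⟨C, hC, hle⟩ := exists_sqrt_det_l2Gram_le_resultant j (θ := 1 / 84) (by norm_num)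
    (by norm_num)
  let cube : Set (Fin 7 → ℝ) := Set.univ.pi fun _ => Metric.closedBall 0 2
  calc _ ≤ ∫⁻ y in lumpDom j, ENNReal.ofReal √|(l2Gram (lumpChart j) y).det| :=
        lintegral_mono_set fun y hy => hy.1
    _ ≤ ∫⁻ y in lumpDom j, C * ‖resultant (num (lumpCoeffs j y)) (den (lumpCoeffs j y)) 3 3‖ₑ ^
          (-(7 * (1 / 84)) : ℝ) := setLIntegral_mono' (isOpen_lumpDom j).measurableSet hle
    _ ≤ ∫⁻ y in cube, C * ‖resultant (num (lumpCoeffs j y)) (den (lumpCoeffs j y)) 3 3‖ₑ ^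
          (-(7 * (1 / 84)) : ℝ) :=
        lintegral_mono_set fun y hy k _ => mem_closedBall_zero_iff.2 (hy.1 k).le
    _ < ⊤ := by
        rw [lintegral_const_mul' _ _ hC]
        exact ENNReal.mul_lt_top hC.lt_top
          (setLIntegral_resultant_rpow_neg_lt_top j (by norm_num) (by norm_num) zero_le_two)

end Volume

section Deformations

variable {p q : ℂ[X]} {u v : ℂ → ℂ}

/-- The tangent vectors, at `p / q`, of the rational maps of the same degree: the fields of the
form `W / q²`, with `W` a polynomial of at most twice that degree. Their values at the roots of `q`
are left free. -/
def deformations (p q : ℂ[X]) : Submodule ℂ (ℂ → ℂ) where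
  carrier := {u | ∃ W : ℂ[X], W.natDegree ≤ 2 * max p.natDegree q.natDegree ∧
    ∀ z, q.eval z ≠ 0 → u z = W.eval z / q.eval z ^ 2}
  add_mem' := by
    rintro u v ⟨W, hW, hu⟩ ⟨W', hW', hv⟩
    refine ⟨W + W', natDegree_add_le_of_degree_le hW hW', fun z hz => ?_⟩
    rw [Pi.add_apply, hu z hz, hv z hz, eval_add, add_div]
  zero_mem' := ⟨0, by simp⟩
  smul_mem' := by
    rintro s u ⟨W, hW, hu⟩
    refine ⟨s • W, (natDegree_smul_le s W).trans hW, fun z hz => ?_⟩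
    rw [Pi.smul_apply, hu z hz, eval_smul, smul_div_assoc]

lemma integrable_l2Density_of_mem_deformations (h : IsCoprime p q) (hq : q ≠ 0)
    (hu : u ∈ deformations p q) (hv : v ∈ deformations p q) :
    Integrable (l2Density (ratMap p q) u v) := by
  obtain ⟨W, hW, hu⟩ := hu
  obtain ⟨W', hW', hv⟩ := hv
  exact integrable_l2Density_ratMap h hq hW hW' hu hv

lemma exists_rotField_eq (i : Fin 3) :
    ∃ α β γ : ℂ, ∀ z, rotField i z = α + β * z + γ * z ^ 2 := by
  fin_cases i
  · exact ⟨Complex.I / 2, 0, -Complex.I / 2, fun z => by simp [rotField]; ring⟩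
  · exact ⟨1 / 2, 0, 1 / 2, fun z => by simp [rotField]; ring⟩
  · exact ⟨0, Complex.I, 0, fun z => by simp [rotField]⟩

lemma rotField_comp_mem_deformations (p q : ℂ[X]) (i : Fin 3) :
    (fun z => rotField i (p.eval z / q.eval z)) ∈ deformations p q := by
  obtain ⟨α, β, γ, h⟩ := exists_rotField_eq i
  have hp := le_max_left p.natDegree q.natDegree
  have hq := le_max_right p.natDegree q.natDegree
  refine ⟨C α * q ^ 2 + C β * (p * q) + C γ * p ^ 2, ?_, fun z hz => ?_⟩
  · refine natDegree_add_le_of_degree_le (natDegree_add_le_of_degree_le ?_ ?_) ?_ <;>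
      refine (natDegree_C_mul_le _ _).trans ?_
    · exact natDegree_pow_le_of_le 2 hq
    · exact (natDegree_mul_le_of_le hp hq).trans_eq (two_mul _).symm
    · exact natDegree_pow_le_of_le 2 hp
  · simp only [h, eval_add, eval_mul, eval_C, eval_pow]
    field_simp

end Deformations

section InnerProduct

variable {R : OnePoint ℂ → OnePoint ℂ} {u v w : ℂ → ℂ}

lemma l2Density_self (R : OnePoint ℂ → OnePoint ℂ) (u : ℂ → ℂ) (z : ℂ) :
    l2Density R u u z = ‖u z‖ ^ 2 / ((1 + ‖affine R z‖ ^ 2) ^ 2 * (1 + ‖z‖ ^ 2) ^ 2) := by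
  rw [l2Density, Complex.mul_conj', ← Complex.ofReal_pow, Complex.ofReal_re]

lemma l2Density_eq_inner (R : OnePoint ℂ → OnePoint ℂ) (u v : ℂ → ℂ) (z : ℂ) :
    l2Density R u v z =
      inner ℝ (v z) (u z) / ((1 + ‖affine R z‖ ^ 2) ^ 2 * (1 + ‖z‖ ^ 2) ^ 2) := by
  rw [l2Density, Complex.inner]

lemma l2Inner_comm (R : OnePoint ℂ → OnePoint ℂ) (u v : ℂ → ℂ) :
    l2Inner R u v = l2Inner R v u := by
  simp only [l2Inner, l2Density_eq_inner, real_inner_comm]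

lemma l2Inner_smul_left (R : OnePoint ℂ → OnePoint ℂ) (s : ℝ) (u v : ℂ → ℂ) :
    l2Inner R (s • u) v = s * l2Inner R u v := by
  simp only [l2Inner, l2Density_eq_inner, Pi.smul_apply, real_inner_smul_right, mul_div_assoc,
    integral_const_mul]

lemma l2Inner_smul_right (R : OnePoint ℂ → OnePoint ℂ) (s : ℝ) (u v : ℂ → ℂ) :
    l2Inner R u (s • v) = s * l2Inner R u v := by
  rw [l2Inner_comm, l2Inner_smul_left, l2Inner_comm]

lemma l2Inner_sum_sum {ι : Type*} [Fintype ι] {f : ι → ℂ → ℂ}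
    (hf : ∀ x y, Integrable (l2Density R (f x) (f y))) :
    l2Inner R (∑ x, f x) (∑ x, f x) = ∑ x, ∑ y, l2Inner R (f x) (f y) := by
  have hdensity : l2Density R (∑ x, f x) (∑ x, f x) =
      fun z => ∑ x, ∑ y, l2Density R (f x) (f y) z := by
    funext z
    simp only [l2Density_eq_inner, Finset.sum_apply, sum_inner, inner_sum, Finset.sum_div]
  rw [l2Inner, hdensity,
    integral_finsetSum _ fun x _ => integrable_finsetSum _ fun y _ => hf x y]
  exact Finset.sum_congr rfl fun x _ => integral_finsetSum _ fun y _ => hf x y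

lemma l2Inner_sum_of_pairwise {ι : Type*} [Fintype ι] {f : ι → ℂ → ℂ}
    (hf : ∀ x y, Integrable (l2Density R (f x) (f y)))
    (horth : Pairwise fun x y => l2Inner R (f x) (f y) = 0) :
    l2Inner R (∑ x, f x) (∑ x, f x) = ∑ x, l2Inner R (f x) (f x) := by
  rw [l2Inner_sum_sum hf]
  exact Finset.sum_congr rfl fun x _ =>
    Finset.sum_eq_single x (fun y _ hyx => horth hyx.symm) (by simp)

lemma l2Inner_smul_add_smul (huu : Integrable (l2Density R u u))
    (huv : Integrable (l2Density R u v)) (hvv : Integrable (l2Density R v v)) (s t : ℝ) :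
    l2Inner R (s • u + t • v) (s • u + t • v) =
      l2Inner R u u * s ^ 2 + l2Inner R v v * t ^ 2 + 2 * l2Inner R u v * (s * t) := by
  have hdensity : l2Density R (s • u + t • v) (s • u + t • v) =
      s ^ 2 • l2Density R u u + t ^ 2 • l2Density R v v + (2 * (s * t)) • l2Density R u v := by
    funext z
    simp only [l2Density_eq_inner, Pi.add_apply, Pi.smul_apply, inner_add_left, inner_add_right,
      real_inner_smul_left, real_inner_smul_right, real_inner_comm (u z) (v z), smul_eq_mul]
    ring
  rw [l2Inner, hdensity, integral_add' ((huu.smul _).add (hvv.smul _)) (huv.smul _),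
    integral_add' (huu.smul _) (hvv.smul _)]
  simp only [Pi.smul_apply, smul_eq_mul, integral_const_mul, l2Inner]
  ring

end InnerProduct

section Parity

variable {T : ℂ ≃ₗᵢ[ℝ] ℂ} {ε ε' : ℝ} {u v : ℂ → ℂ} {R : OnePoint ℂ → OnePoint ℂ}

/-- A vector field `u` has parity `ε` under a linear isometry `T` of the plane if transporting `u`
by `T` multiplies it by `ε`. -/
def HasParity (T : ℂ ≃ₗᵢ[ℝ] ℂ) (ε : ℝ) (u : ℂ → ℂ) : Prop :=
  ∀ᵐ z, u (T z) = ε • T (u z)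

namespace HasParity

lemma add (hu : HasParity T ε u) (hv : HasParity T ε v) : HasParity T ε (u + v) := by
  filter_upwards [hu, hv] with z hu hv
  rw [Pi.add_apply, Pi.add_apply, hu, hv, map_add, smul_add]

lemma const_smul (hu : HasParity T ε u) (s : ℝ) : HasParity T ε (s • u) := by
  filter_upwards [hu] with z hu
  rw [Pi.smul_apply, Pi.smul_apply, hu, map_smul, smul_comm]

lemma l2Inner_eq_zero (hR : ∀ z, affine R (T z) = T (affine R z)) (hu : HasParity T ε u)
    (hv : HasParity T ε' v) (hε : ε * ε' ≠ 1) : l2Inner R u v = 0 := by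
  have hdensity : (fun z => l2Density R u v (T z)) =ᵐ[volume]
      fun z => ε * ε' * l2Density R u v z := by
    filter_upwards [hu, hv] with z hu hv
    simp only [l2Density_eq_inner, hu, hv, hR, T.norm_map, real_inner_smul_left,
      real_inner_smul_right, T.inner_map_map]
    ring
  have hinvariant : l2Inner R u v = ε * ε' * l2Inner R u v := by
    conv_lhs => rw [l2Inner, ← T.measurePreserving.integral_comp
      T.toHomeomorph.measurableEmbedding, integral_congr_ae hdensity, integral_const_mul]
    rfl
  by_contra hne
  exact hε (mul_eq_right₀ hne |>.1 hinvariant.symm)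

end HasParity

end Parity

section SymmetricMap

variable {c : ℝ} {z : ℂ}

lemma affine_Rc (c : ℝ) (z : ℂ) : affine (Rc c) z = (z ^ 3 + c * z) / (c * z ^ 2 + 1) := by
  rw [Rc, affine_ratMap]
  simp

lemma natDegree_X_pow_three_add (c : ℝ) : (X ^ 3 + C (c : ℂ) * X).natDegree = 3 := by
  compute_degree!

lemma C_mul_X_sq_add_one_ne_zero (c : ℝ) : C (c : ℂ) * X ^ 2 + 1 ≠ 0 := fun h => by
  simpa using congrArg (eval 0) h

lemma max_natDegree_Rc (c : ℝ) :
    max (X ^ 3 + C (c : ℂ) * X).natDegree (C (c : ℂ) * X ^ 2 + 1).natDegree = 3 := by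
  rw [natDegree_X_pow_three_add]
  refine max_eq_left ?_
  compute_degree!

lemma isCoprime_Rc (hc : c ^ 2 ≠ 1) :
    IsCoprime (X ^ 3 + C (c : ℂ) * X) (C (c : ℂ) * X ^ 2 + 1) := by
  rw [isCoprime_iff]
  rintro z ⟨hp, hq⟩
  simp only [eval_add, eval_pow, eval_X, eval_mul, eval_C, eval_one] at hp hq
  have hz : z * ((c : ℂ) ^ 2 - 1) = 0 := by linear_combination (c : ℂ) * hp - z * hq
  rcases mul_eq_zero.1 hz with rfl | h
  · simp at hq
  · exact hc (by exact_mod_cast sub_eq_zero.1 h)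

lemma hasDerivAt_affine_Rc_comp {c : ℝ → ℝ} {w : ℝ → ℂ} {t₀ c' : ℝ} {w' : ℂ}
    (hc : HasDerivAt c c' t₀) (hw : HasDerivAt w w' t₀) (hq : (c t₀ : ℂ) * w t₀ ^ 2 + 1 ≠ 0) :
    HasDerivAt (fun t => affine (Rc (c t)) (w t))
      ((((c t₀ : ℂ) * w t₀ ^ 4 + (3 - (c t₀ : ℂ) ^ 2) * w t₀ ^ 2 + c t₀) * w' +
        (w t₀ - w t₀ ^ 5) * c') / (c t₀ * w t₀ ^ 2 + 1) ^ 2) t₀ := by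
  have hc := hc.ofReal_comp
  simp only [affine_Rc]
  refine (((hw.fun_pow 3).fun_add (hc.fun_mul hw)).div
    ((hc.fun_mul (hw.fun_pow 2)).add_const 1) hq).congr_deriv ?_
  congr 1
  push_cast
  ring

lemma hasDerivAt_affine_Rc (hz : (c : ℂ) * z ^ 2 + 1 ≠ 0) :
    HasDerivAt (affine (Rc c))
      ((c * z ^ 4 + (3 - (c : ℂ) ^ 2) * z ^ 2 + c) / (c * z ^ 2 + 1) ^ 2) z := by
  have hnum : HasDerivAt (fun z : ℂ => z ^ 3 + c * z) (3 * z ^ 2 + c) z := by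
    simpa using (hasDerivAt_pow 3 z).fun_add ((hasDerivAt_id' z).const_mul (c : ℂ))
  have hden : HasDerivAt (fun z : ℂ => c * z ^ 2 + 1) (c * (2 * z)) z := by
    simpa using ((hasDerivAt_pow 2 z).const_mul (c : ℂ)).add_const 1
  rw [funext (affine_Rc c)]
  refine (hnum.div hden hz).congr_deriv ?_
  congr 1
  ring

lemma hasDerivAt_affine_Rc_param (hz : (c : ℂ) * z ^ 2 + 1 ≠ 0) :
    HasDerivAt (fun s : ℝ => affine (Rc s) z) ((z - z ^ 5) / (c * z ^ 2 + 1) ^ 2) c := by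
  simpa using hasDerivAt_affine_Rc_comp (hasDerivAt_id' c) (hasDerivAt_const c z) hz

lemma ae_Rc_den_ne_zero (c : ℝ) : ∀ᵐ z : ℂ, (c : ℂ) * z ^ 2 + 1 ≠ 0 := by
  simpa using ae_eval_ne_zero (C_mul_X_sq_add_one_ne_zero c)

/-- The deformation of `R_c` by the `i`-th infinitesimal rotation of its domain. -/
def domainField (c : ℝ) (i : Fin 3) (z : ℂ) : ℂ := rotField i z * deriv (affine (Rc c)) z

/-- The deformation of `R_c` by the `i`-th infinitesimal rotation of its target. -/
def targetField (c : ℝ) (i : Fin 3) (z : ℂ) : ℂ := rotField i (affine (Rc c) z)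

/-- The deformation of `R_c` in the direction of its parameter. -/
def paramField (c : ℝ) (z : ℂ) : ℂ := deriv (fun s : ℝ => affine (Rc s) z) c

lemma metricA_eq (i : Fin 3) (c : ℝ) :
    metricA i c = l2Inner (Rc c) (domainField c i) (domainField c i) := by
  simp only [metricA, l2Inner, l2Density_self, domainField, norm_mul, mul_pow]

lemma metricD_eq (i : Fin 3) (c : ℝ) :
    metricD i c = l2Inner (Rc c) (targetField c i) (targetField c i) := by
  simp only [metricD, l2Inner, l2Density_self, targetField]

lemma metricC_eq (c : ℝ) : metricC c = l2Inner (Rc c) (paramField c) (paramField c) := by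
  simp only [metricC, l2Inner, l2Density_self, paramField]

lemma metricF_eq (i : Fin 3) (c : ℝ) :
    metricF i c = 2 * l2Inner (Rc c) (domainField c i) (targetField c i) := rfl

/-- The tangent vectors of the space of rational maps at `R_c`. -/
abbrev deformationsRc (c : ℝ) : Submodule ℂ (ℂ → ℂ) :=
  deformations (X ^ 3 + C (c : ℂ) * X) (C (c : ℂ) * X ^ 2 + 1)

lemma domainField_mem_deformationsRc (c : ℝ) (i : Fin 3) :
    domainField c i ∈ deformationsRc c := by
  obtain ⟨α, β, γ, h⟩ := exists_rotField_eq i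
  refine ⟨(C α + C β * X + C γ * X ^ 2) *
    (C (c : ℂ) * X ^ 4 + C (3 - (c : ℂ) ^ 2) * X ^ 2 + C (c : ℂ)), ?_, fun z hz => ?_⟩
  · rw [max_natDegree_Rc]
    compute_degree!
  · have hz : (c : ℂ) * z ^ 2 + 1 ≠ 0 := by simpa using hz
    rw [domainField, (hasDerivAt_affine_Rc hz).deriv, h, ← mul_div_assoc]
    simp

lemma targetField_mem_deformationsRc (c : ℝ) (i : Fin 3) :
    targetField c i ∈ deformationsRc c := by
  have hfield : targetField c i = fun z => rotField i
      ((X ^ 3 + C (c : ℂ) * X).eval z / (C (c : ℂ) * X ^ 2 + 1).eval z) :=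
    funext fun z => by rw [targetField, Rc, affine_ratMap]
  rw [hfield]
  exact rotField_comp_mem_deformations _ _ i

lemma paramField_mem_deformationsRc (c : ℝ) : paramField c ∈ deformationsRc c := by
  refine ⟨X - X ^ 5, ?_, fun z hz => ?_⟩
  · rw [max_natDegree_Rc]
    compute_degree!
  · have hz : (c : ℂ) * z ^ 2 + 1 ≠ 0 := by simpa using hz
    rw [paramField, (hasDerivAt_affine_Rc_param hz).deriv]
    simp

lemma integrable_l2Density_Rc {u v : ℂ → ℂ} (hc : c ^ 2 ≠ 1) (hu : u ∈ deformationsRc c)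
    (hv : v ∈ deformationsRc c) : Integrable (l2Density (Rc c) u v) :=
  integrable_l2Density_of_mem_deformations (isCoprime_Rc hc) (C_mul_X_sq_add_one_ne_zero c) hu hv

end SymmetricMap

section SymmetryParity

variable {T : ℂ ≃ₗᵢ[ℝ] ℂ} {ε : ℝ} {c : ℝ} {i : Fin 3}

lemma deriv_mul_apply_eq {f : ℂ → ℂ} {z : ℂ} (hf : ∀ w, f (T w) = T (f w))
    (hz : DifferentiableAt ℂ f z) (hTz : DifferentiableAt ℂ f (T z)) (v : ℂ) :
    deriv f (T z) * T v = T (deriv f z * v) := by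
  have hleft : HasFDerivAt (fun w => f (T w)) _ z :=
    (hTz.hasDerivAt.hasFDerivAt.restrictScalars ℝ).comp z T.toContinuousLinearEquiv.hasFDerivAt
  have hright : HasFDerivAt (fun w => T (f w)) _ z :=
    T.toContinuousLinearEquiv.hasFDerivAt.comp z (hz.hasDerivAt.hasFDerivAt.restrictScalars ℝ)
  rw [funext hf] at hleft
  simpa [mul_comm] using congrArg (fun L => L v) (hleft.unique hright)

lemma hasParity_targetField (hR : ∀ z, affine (Rc c) (T z) = T (affine (Rc c) z))
    (hrot : ∀ z, rotField i (T z) = ε • T (rotField i z)) :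
    HasParity T ε (targetField c i) :=
  .of_forall fun z => by rw [targetField, targetField, hR, hrot]

lemma hasParity_domainField (hR : ∀ z, affine (Rc c) (T z) = T (affine (Rc c) z))
    (hrot : ∀ z, rotField i (T z) = ε • T (rotField i z)) :
    HasParity T ε (domainField c i) := by
  filter_upwards [ae_Rc_den_ne_zero c,
    T.measurePreserving.quasiMeasurePreserving.ae (ae_Rc_den_ne_zero c)] with z hz hTz
  rw [domainField, domainField, hrot, smul_mul_assoc, mul_comm, mul_comm (rotField i z),
    deriv_mul_apply_eq hR (hasDerivAt_affine_Rc hz).differentiableAt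
      (hasDerivAt_affine_Rc hTz).differentiableAt]

lemma hasParity_paramField (hR : ∀ (s : ℝ) (z : ℂ), affine (Rc s) (T z) = T (affine (Rc s) z)) :
    HasParity T 1 (paramField c) := by
  filter_upwards [ae_Rc_den_ne_zero c] with z hz
  simp only [paramField, hR, one_smul]
  exact (T.toContinuousLinearEquiv.hasFDerivAt.comp_hasDerivAt c
    (hasDerivAt_affine_Rc_param hz).differentiableAt.hasDerivAt).deriv

lemma affine_Rc_neg (c : ℝ) (z : ℂ) : affine (Rc c) (-z) = -affine (Rc c) z := by
  rw [affine_Rc, affine_Rc, ← neg_div]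
  congr 1 <;> ring

lemma affine_Rc_conj (c : ℝ) (z : ℂ) : affine (Rc c) (conj z) = conj (affine (Rc c) z) := by
  simp [affine_Rc]

lemma rotField_neg (i : Fin 3) (z : ℂ) :
    rotField i (-z) = ((![-1, -1, 1] i : ℤ) : ℝ) • -rotField i z := by
  fin_cases i <;> simp [rotField]

lemma rotField_conj (i : Fin 3) (z : ℂ) :
    rotField i (conj z) = ((![-1, 1, -1] i : ℤ) : ℝ) • conj (rotField i z) := by
  fin_cases i <;> simp [rotField, neg_div, map_ofNat]

end SymmetryParity

section SymmetricOrbit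

/-- The deformation of `R_c` with velocities `c'` in the parameter and `σ`, `η` in the rotations of
domain and target, split into its parts of different parities: the part along the parameter, and
one part for each rotation axis. -/
def orbitField (c c' : ℝ) (σ η : Fin 3 → ℝ) : Option (Fin 3) → ℂ → ℂ
  | none => c' • paramField c
  | some i => σ i • domainField c i + η i • targetField c i

variable {c c' : ℝ} {σ η : Fin 3 → ℝ}

lemma orbitField_mem_deformationsRc (c c' : ℝ) (σ η : Fin 3 → ℝ) (x : Option (Fin 3)) :
    orbitField c c' σ η x ∈ deformationsRc c := by
  rcases x with _ | i
  · exact Submodule.smul_of_tower_mem _ c' (paramField_mem_deformationsRc c)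
  · exact add_mem (Submodule.smul_of_tower_mem _ _ (domainField_mem_deformationsRc c i))
      (Submodule.smul_of_tower_mem _ _ (targetField_mem_deformationsRc c i))

lemma hasParity_orbitField {T : ℂ ≃ₗᵢ[ℝ] ℂ} {ε : Fin 3 → ℤ}
    (hR : ∀ (s : ℝ) (z : ℂ), affine (Rc s) (T z) = T (affine (Rc s) z))
    (hrot : ∀ i z, rotField i (T z) = (ε i : ℝ) • T (rotField i z)) (x : Option (Fin 3)) :
    HasParity T (x.elim 1 ε : ℤ) (orbitField c c' σ η x) := by
  rcases x with _ | i
  · simpa [orbitField] using (hasParity_paramField hR).const_smul c'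
  · exact ((hasParity_domainField (hR c) (hrot i)).const_smul _).add
      ((hasParity_targetField (hR c) (hrot i)).const_smul _)

/-- The half turn and the complex conjugation tell the four parts apart: their pairs of parities
are `(1, 1)`, `(-1, -1)`, `(-1, 1)` and `(1, -1)`. -/
lemma pairwise_l2Inner_orbitField :
    Pairwise fun x y => l2Inner (Rc c) (orbitField c c' σ η x) (orbitField c c' σ η y) = 0 := by
  intro x y hxy
  have hneg := hasParity_orbitField (c := c) (c' := c') (σ := σ) (η := η)
    (T := .neg ℝ) affine_Rc_neg rotField_neg
  have hconj := hasParity_orbitField (c := c) (c' := c') (σ := σ) (η := η)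
    (T := Complex.conjLIE) affine_Rc_conj rotField_conj
  have hparity : (x.elim 1 ![-1, -1, 1] : ℤ) * y.elim 1 ![-1, -1, 1] ≠ 1 ∨
      (x.elim 1 ![-1, 1, -1] : ℤ) * y.elim 1 ![-1, 1, -1] ≠ 1 := by
    revert x y
    decide
  rcases hparity with h | h
  · exact (hneg x).l2Inner_eq_zero (affine_Rc_neg c) (hneg y) (mod_cast h)
  · exact (hconj x).l2Inner_eq_zero (affine_Rc_conj c) (hconj y) (mod_cast h)

lemma l2Inner_sum_orbitField (hc : c ^ 2 ≠ 1) :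
    l2Inner (Rc c) (∑ x, orbitField c c' σ η x) (∑ x, orbitField c c' σ η x) =
      metricC c * c' ^ 2 +
        ∑ i, (metricA i c * σ i ^ 2 + metricD i c * η i ^ 2 + metricF i c * (σ i * η i)) := by
  rw [l2Inner_sum_of_pairwise (fun x y => integrable_l2Density_Rc hc
    (orbitField_mem_deformationsRc c c' σ η x) (orbitField_mem_deformationsRc c c' σ η y))
    pairwise_l2Inner_orbitField, Fintype.sum_option]
  congr 1
  · rw [orbitField, l2Inner_smul_left, l2Inner_smul_right, metricC_eq]
    ring
  · refine Finset.sum_congr rfl fun i _ => ?_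
    have ha := domainField_mem_deformationsRc c i
    have hd := targetField_mem_deformationsRc c i
    rw [orbitField, l2Inner_smul_add_smul (integrable_l2Density_Rc hc ha ha)
      (integrable_l2Density_Rc hc ha hd) (integrable_l2Density_Rc hc hd hd), metricA_eq, metricD_eq,
      metricF_eq]

end SymmetricOrbit

section Isometry

variable {A U M : Matrix (Fin 2) (Fin 2) ℂ} {z : ℂ}

lemma norm_mobiusNum_sq_add_norm_mobiusDen_sq (hA : A ∈ Matrix.unitaryGroup (Fin 2) ℂ) (z : ℂ) :
    ‖mobiusNum A z‖ ^ 2 + ‖mobiusDen A z‖ ^ 2 = 1 + ‖z‖ ^ 2 := by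
  have h := Matrix.mem_unitaryGroup_iff'.1 hA
  have h₀₀ := congrFun (congrFun h 0) 0
  have h₀₁ := congrFun (congrFun h 0) 1
  have h₁₀ := congrFun (congrFun h 1) 0
  have h₁₁ := congrFun (congrFun h 1) 1
  simp only [Matrix.mul_apply, Fin.sum_univ_two, Matrix.star_apply, RCLike.star_def,
    Matrix.one_apply_eq, Matrix.one_apply_ne (zero_ne_one : (0 : Fin 2) ≠ 1),
    Matrix.one_apply_ne (one_ne_zero : (1 : Fin 2) ≠ 0)] at h₀₀ h₀₁ h₁₀ h₁₁
  rw [← Complex.ofReal_inj]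
  push_cast
  simp only [← Complex.mul_conj', mobiusNum, mobiusDen, map_add, map_mul]
  linear_combination z * conj z * h₀₀ + conj z * h₀₁ + z * h₁₀ + h₁₁

lemma one_add_norm_mobius_sq (hA : A ∈ Matrix.unitaryGroup (Fin 2) ℂ) (hz : mobiusDen A z ≠ 0) :
    1 + ‖mobius A z‖ ^ 2 = (1 + ‖z‖ ^ 2) / ‖mobiusDen A z‖ ^ 2 := by
  have hz : ‖mobiusDen A z‖ ≠ 0 := norm_ne_zero_iff.2 hz
  rw [← norm_mobiusNum_sq_add_norm_mobiusDen_sq hA z, mobius, norm_div]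
  field_simp
  ring

lemma norm_det_of_mem_unitaryGroup (hA : A ∈ Matrix.unitaryGroup (Fin 2) ℂ) : ‖A.det‖ = 1 :=
  CStarRing.norm_of_mem_unitary (Matrix.det_of_mem_unitary hA)

lemma det_ne_zero_of_mem_unitaryGroup (hA : A ∈ Matrix.unitaryGroup (Fin 2) ℂ) : A.det ≠ 0 :=
  norm_ne_zero_iff.1 (by rw [norm_det_of_mem_unitaryGroup hA]; exact one_ne_zero)

lemma l2Density_self_of_mobius {R S : OnePoint ℂ → OnePoint ℂ} {u v : ℂ → ℂ}
    (hU : U ∈ Matrix.unitaryGroup (Fin 2) ℂ) (hM : M ∈ Matrix.unitaryGroup (Fin 2) ℂ)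
    (hz : mobiusDen U z ≠ 0) (hm : mobiusDen M (affine S (mobius U z)) ≠ 0)
    (hR : affine R z = mobius M (affine S (mobius U z)))
    (hu : u z = M.det * v (mobius U z) / mobiusDen M (affine S (mobius U z)) ^ 2) :
    l2Density R u u z =
      ‖U.det / mobiusDen U z ^ 2‖ ^ 2 • l2Density S v v (mobius U z) := by
  have hz : ‖mobiusDen U z‖ ≠ 0 := norm_ne_zero_iff.2 hz
  rw [l2Density_self, l2Density_self, hR, one_add_norm_mobius_sq hM hm,
    one_add_norm_mobius_sq hU (norm_ne_zero_iff.1 hz), hu, smul_eq_mul]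
  have hm : ‖mobiusDen M (affine S (mobius U z))‖ ≠ 0 := norm_ne_zero_iff.2 hm
  simp only [norm_div, norm_mul, norm_pow, norm_det_of_mem_unitaryGroup hU,
    norm_det_of_mem_unitaryGroup hM]
  field_simp

lemma l2Inner_self_of_mobius {R S : OnePoint ℂ → OnePoint ℂ} {u v : ℂ → ℂ}
    (hU : U ∈ Matrix.unitaryGroup (Fin 2) ℂ) (hM : M ∈ Matrix.unitaryGroup (Fin 2) ℂ)
    (hm : ∀ᵐ z, mobiusDen M (affine S (mobius U z)) ≠ 0)
    (hR : ∀ᵐ z, affine R z = mobius M (affine S (mobius U z)))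
    (hu : ∀ᵐ z, u z = M.det * v (mobius U z) / mobiusDen M (affine S (mobius U z)) ^ 2) :
    l2Inner R u u = l2Inner S v v := by
  have hdet := det_ne_zero_of_mem_unitaryGroup hU
  rw [l2Inner, l2Inner, integral_mobius hdet (l2Density S v v)]
  refine integral_congr_ae ?_
  filter_upwards [ae_mobiusDen_ne_zero hdet, hm, hR, hu] with z hz hm hR hu
  exact l2Density_self_of_mobius hU hM hz hm hR hu

lemma ae_mobius_of_ae (hA : A.det ≠ 0) {p : ℂ → Prop} (hp : ∀ᵐ w, p w) :
    ∀ᵐ z, p (mobius A z) := by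
  have hnull : volume (mobius A.adjugate '' ({w | mobiusDen A.adjugate w ≠ 0} ∩ {w | ¬p w})) = 0 :=
    addHaar_image_eq_zero_of_differentiableOn_of_addHaar_eq_zero volume
      (fun w hw => ((hasDerivAt_mobius _ hw.1).differentiableAt.restrictScalars
        ℝ).differentiableWithinAt) (measure_mono_null Set.inter_subset_right hp)
  filter_upwards [ae_mobiusDen_ne_zero hA, measure_eq_zero_iff_ae_notMem.1 hnull] with z hz himage
  by_contra hpz
  exact himage ⟨mobius A z, ⟨(bijOn_mobius hA).mapsTo hz, hpz⟩, mobius_adjugate_mobius hA hz⟩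

end Isometry

section MobiusFlow

variable {A : ℝ → Matrix (Fin 2) (Fin 2) ℂ} {B : Matrix (Fin 2) (Fin 2) ℂ} {t₀ : ℝ} {z : ℂ}

/-- The vector field of the infinitesimal Möbius transformation of a `2 × 2` matrix, that is, the
derivative of `mobius (1 + t B)` at `t = 0`. -/
def mobiusField (B : Matrix (Fin 2) (Fin 2) ℂ) (z : ℂ) : ℂ :=
  B 0 1 + (B 0 0 - B 1 1) * z - B 1 0 * z ^ 2

lemma mobiusField_su2 (ξ : Fin 3 → ℝ) (z : ℂ) :
    mobiusField (su2 ξ) z = ∑ i, (ξ i : ℂ) * rotField i z := by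
  simp only [mobiusField, su2, su2Basis, rotField, Fin.sum_univ_three, Matrix.add_apply]
  simp
  ring

lemma hasDerivAt_mobius_of_mul_left
    (hA : ∀ a b, HasDerivAt (fun t => A t a b) ((B * A t₀) a b) t₀) (hz : mobiusDen (A t₀) z ≠ 0) :
    HasDerivAt (fun t => mobius (A t) z) (mobiusField B (mobius (A t₀) z)) t₀ := by
  refine ((((hA 0 0).mul_const z).fun_add (hA 0 1)).div
    (((hA 1 0).mul_const z).fun_add (hA 1 1)) hz).congr_deriv ?_
  have hrow (i : Fin 2) : (B * A t₀) i 0 * z + (B * A t₀) i 1 =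
      B i 0 * mobiusNum (A t₀) z + B i 1 * mobiusDen (A t₀) z := by
    simp only [Matrix.mul_apply, Fin.sum_univ_two, mobiusNum, mobiusDen]
    ring
  rw [hrow, hrow, mobiusField, mobius, ← mobiusNum, ← mobiusDen]
  field_simp
  ring

lemma hasDerivAt_mobius_of_mul_right
    (hA : ∀ a b, HasDerivAt (fun t => A t a b) ((A t₀ * B) a b) t₀) {r : ℝ → ℂ} {r' : ℂ}
    (hr : HasDerivAt r r' t₀) (hz : mobiusDen (A t₀) (r t₀) ≠ 0) :
    HasDerivAt (fun t => mobius (A t) (r t))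
      ((A t₀).det * (r' + mobiusField B (r t₀)) / mobiusDen (A t₀) (r t₀) ^ 2) t₀ := by
  refine ((((hA 0 0).fun_mul hr).fun_add (hA 0 1)).div
    (((hA 1 0).fun_mul hr).fun_add (hA 1 1)) hz).congr_deriv ?_
  simp only [Matrix.mul_apply, Fin.sum_univ_two, Matrix.det_fin_two, mobiusField, mobiusDen]
  congr 1
  ring

end MobiusFlow

section Orbit

lemma affine_orbitMap {U M : GL (Fin 2) ℂ} {c : ℝ} {z : ℂ} (hz : mobiusDen U z ≠ 0)
    (hq : (c : ℂ) * mobius U z ^ 2 + 1 ≠ 0) :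
    affine (orbitMap U M c) z = mobius M (affine (Rc c) (mobius U z)) := by
  have hU : U • (z : OnePoint ℂ) = mobius U z := by
    rw [OnePoint.smul_some_eq_ite]
    exact if_neg hz
  have hRc : Rc c (mobius U z : OnePoint ℂ) = (affine (Rc c) (mobius U z) : ℂ) := by
    rw [Rc, ratMap_coe, if_neg (by simpa using hq), affine_ratMap]
  generalize affine (Rc c) (mobius U z) = r at hRc ⊢
  rw [affine, orbitMap, hU, hRc, OnePoint.smul_some_eq_ite]
  split_ifs with h
  · rw [mobius, mobiusDen, h, div_zero]
    rfl
  · rfl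

lemma sum_orbitField_apply (c c' : ℝ) (σ η : Fin 3 → ℝ) (w : ℂ) :
    (∑ x, orbitField c c' σ η x) w = deriv (affine (Rc c)) w * mobiusField (su2 σ) w +
      c' * paramField c w + mobiusField (su2 η) (affine (Rc c) w) := by
  simp only [Fintype.sum_option, orbitField, Pi.add_apply, Finset.sum_apply, Pi.smul_apply,
    Complex.real_smul, domainField, targetField, mobiusField_su2, ← mul_assoc,
    Finset.sum_add_distrib, ← Finset.sum_mul]
  ring

variable {U M : ℝ → GL (Fin 2) ℂ} {c : ℝ → ℝ} {t₀ c' : ℝ} {σ η : Fin 3 → ℝ}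

lemma deriv_affine_orbitMap (hc : HasDerivAt c c' t₀)
    (hU : ∀ a b, HasDerivAt (fun t => (U t).val a b) ((su2 σ * (U t₀).val) a b) t₀)
    (hM : ∀ a b, HasDerivAt (fun t => (M t).val a b) (((M t₀).val * su2 η) a b) t₀) {z : ℂ}
    (hz : mobiusDen (U t₀) z ≠ 0) (hq : (c t₀ : ℂ) * mobius (U t₀) z ^ 2 + 1 ≠ 0)
    (hm : mobiusDen (M t₀) (affine (Rc (c t₀)) (mobius (U t₀) z)) ≠ 0) :
    deriv (fun t => affine (orbitMap (U t) (M t) (c t)) z) t₀ =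
      (M t₀).val.det * (∑ x, orbitField (c t₀) c' σ η x) (mobius (U t₀) z) /
        mobiusDen (M t₀) (affine (Rc (c t₀)) (mobius (U t₀) z)) ^ 2 := by
  have hw := hasDerivAt_mobius_of_mul_left hU hz
  rw [sum_orbitField_apply, paramField, (hasDerivAt_affine_Rc hq).deriv,
    (hasDerivAt_affine_Rc_param hq).deriv, div_mul_eq_mul_div, mul_div_assoc', ← add_div,
    mul_comm (c' : ℂ)]
  have hderiv := hasDerivAt_mobius_of_mul_right hM (hasDerivAt_affine_Rc_comp hc hw hq) hm
  refine (hderiv.congr_of_eventuallyEq ?_).deriv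
  have hz_near : ∀ᶠ t in nhds t₀, mobiusDen (U t) z ≠ 0 :=
    (((hU 1 0).mul_const z).fun_add (hU 1 1)).continuousAt.eventually_ne hz
  have hq_near : ∀ᶠ t in nhds t₀, (c t : ℂ) * mobius (U t) z ^ 2 + 1 ≠ 0 :=
    ((hc.ofReal_comp.fun_mul (hw.fun_pow 2)).add_const 1).continuousAt.eventually_ne hq
  filter_upwards [hz_near, hq_near] with t hz hq
  exact affine_orbitMap hz hq

lemma ae_mobiusDen_affine_Rc_ne_zero {A : Matrix (Fin 2) (Fin 2) ℂ} (hA : A.det ≠ 0) (c : ℝ) :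
    ∀ᵐ w, mobiusDen A (affine (Rc c) w) ≠ 0 := by
  have hp : C (A 1 0) * (X ^ 3 + C (c : ℂ) * X) + C (A 1 1) * (C (c : ℂ) * X ^ 2 + 1) ≠ 0 := by
    intro hp
    have h₃ : A 1 0 = 0 := by simpa [coeff_one] using congrArg (coeff · 3) hp
    have h₀ : A 1 1 = 0 := by simpa using congrArg (eval 0) hp
    exact hA (by rw [Matrix.det_fin_two, h₀, h₃, mul_zero, mul_zero, sub_zero])
  filter_upwards [ae_eval_ne_zero hp, ae_Rc_den_ne_zero c] with w hp hq
  have hden : mobiusDen A (affine (Rc c) w) =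
      (A 1 0 * (w ^ 3 + c * w) + A 1 1 * (c * w ^ 2 + 1)) / (c * w ^ 2 + 1) := by
    rw [mobiusDen, affine_Rc, mul_div_assoc', div_add' _ _ _ hq]
  rw [hden]
  exact div_ne_zero (by simpa using hp) hq

theorem l2Inner_deriv_affine_orbitMap (hUu : (U t₀).val ∈ Matrix.unitaryGroup (Fin 2) ℂ)
    (hMu : (M t₀).val ∈ Matrix.unitaryGroup (Fin 2) ℂ) (hc1 : c t₀ ^ 2 ≠ 1)
    (hc : HasDerivAt c c' t₀)
    (hU : ∀ a b, HasDerivAt (fun t => (U t).val a b) ((su2 σ * (U t₀).val) a b) t₀)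
    (hM : ∀ a b, HasDerivAt (fun t => (M t).val a b) (((M t₀).val * su2 η) a b) t₀) :
    l2Inner (orbitMap (U t₀) (M t₀) (c t₀))
        (fun z => deriv (fun t => affine (orbitMap (U t) (M t) (c t)) z) t₀)
        (fun z => deriv (fun t => affine (orbitMap (U t) (M t) (c t)) z) t₀) =
      metricC (c t₀) * c' ^ 2 +
        ∑ i, (metricA i (c t₀) * σ i ^ 2 + metricD i (c t₀) * η i ^ 2 +
          metricF i (c t₀) * (σ i * η i)) := by
  have hdetU := det_ne_zero_of_mem_unitaryGroup hUu
  have hdetM := det_ne_zero_of_mem_unitaryGroup hMu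
  have hz := ae_mobiusDen_ne_zero hdetU
  have hq := ae_mobius_of_ae hdetU (ae_Rc_den_ne_zero (c t₀))
  have hm := ae_mobius_of_ae hdetU (ae_mobiusDen_affine_Rc_ne_zero hdetM (c t₀))
  rw [← l2Inner_sum_orbitField hc1]
  refine l2Inner_self_of_mobius hUu hMu hm ?_ ?_
  · filter_upwards [hz, hq] with z hz hq
    exact affine_orbitMap hz hq
  · filter_upwards [hz, hq, hm] with z hz hq hm
    exact deriv_affine_orbitMap hc hU hM hz hq hm

end Orbit

end Lump

end

theorem mainTheorem3_general :
    (∀ (j : Fin 8), ∀ y ∈ Lump.lumpDom j, ∀ k l : Fin 7,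
      MeasureTheory.Integrable (Lump.l2Density (Lump.lumpChart j y)
        (Lump.partialField (Lump.lumpChart j) y k)
        (Lump.partialField (Lump.lumpChart j) y l))) ∧
    (∀ (U M : ℝ → GL (Fin 2) ℂ) (c : ℝ → ℝ) (t₀ c' : ℝ) (σ η : Fin 3 → ℝ),
      (U t₀ : Matrix (Fin 2) (Fin 2) ℂ) ∈ Matrix.unitaryGroup (Fin 2) ℂ →
      (M t₀ : Matrix (Fin 2) (Fin 2) ℂ) ∈ Matrix.unitaryGroup (Fin 2) ℂ →
      c t₀ ^ 2 ≠ 1 → HasDerivAt c c' t₀ →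
      (∀ a b, HasDerivAt (fun t => (U t : Matrix (Fin 2) (Fin 2) ℂ) a b)
        ((Lump.su2 σ * (U t₀ : Matrix (Fin 2) (Fin 2) ℂ)) a b) t₀) →
      (∀ a b, HasDerivAt (fun t => (M t : Matrix (Fin 2) (Fin 2) ℂ) a b)
        (((M t₀ : Matrix (Fin 2) (Fin 2) ℂ) * Lump.su2 η) a b) t₀) →
      Lump.l2Inner (Lump.orbitMap (U t₀) (M t₀) (c t₀))
          (fun z => deriv (fun t => Lump.affine (Lump.orbitMap (U t) (M t) (c t)) z) t₀)
          (fun z => deriv (fun t => Lump.affine (Lump.orbitMap (U t) (M t) (c t)) z) t₀) =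
        Lump.metricC (c t₀) * c' ^ 2 +
          ∑ i, (Lump.metricA i (c t₀) * σ i ^ 2 + Lump.metricD i (c t₀) * η i ^ 2 +
            Lump.metricF i (c t₀) * (σ i * η i))) ∧
    Lump.lumpVolume < ⊤ :=
  ⟨fun _ _ hy k l => Lump.integrable_l2Density_lumpChart hy k l,
    fun _ _ _ _ _ _ _ hU₀ hM₀ hc₀ hc hU hM =>
      Lump.l2Inner_deriv_affine_orbitMap hU₀ hM₀ hc₀ hc hU hM,
    Lump.lumpVolume_lt_top⟩

theorem mainTheorem3 :
    -- the `L²` metric is well defined in every coordinate system of the moduli space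
    (∀ (j : Fin 8), ∀ y ∈ Lump.lumpDom j, ∀ k l : Fin 7,
      MeasureTheory.Integrable (Lump.l2Density (Lump.lumpChart j y)
        (Lump.partialField (Lump.lumpChart j) y k)
        (Lump.partialField (Lump.lumpChart j) y l))) ∧
    -- on the symmetry orbits it is `C dc² + ∑ (A_ii σ_i² + D_ii η_i² + F_ii σ_i η_i)`
    (∀ (U M : ℝ → GL (Fin 2) ℂ) (c : ℝ → ℝ) (t₀ c' : ℝ) (σ η : Fin 3 → ℝ),
      (∀ t, (U t : Matrix (Fin 2) (Fin 2) ℂ) ∈ Matrix.specialUnitaryGroup (Fin 2) ℂ) →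
      (∀ t, (M t : Matrix (Fin 2) (Fin 2) ℂ) ∈ Matrix.specialUnitaryGroup (Fin 2) ℂ) →
      0 ≤ c t₀ → c t₀ ≠ 1 → HasDerivAt c c' t₀ →
      (∀ a b, HasDerivAt (fun t => (U t : Matrix (Fin 2) (Fin 2) ℂ) a b)
        ((Lump.su2 σ * (U t₀ : Matrix (Fin 2) (Fin 2) ℂ)) a b) t₀) →
      (∀ a b, HasDerivAt (fun t => (M t : Matrix (Fin 2) (Fin 2) ℂ) a b)
        (((M t₀ : Matrix (Fin 2) (Fin 2) ℂ) * Lump.su2 η) a b) t₀) →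
      Lump.l2Inner (Lump.orbitMap (U t₀) (M t₀) (c t₀))
          (fun z => deriv (fun t => Lump.affine (Lump.orbitMap (U t) (M t) (c t)) z) t₀)
          (fun z => deriv (fun t => Lump.affine (Lump.orbitMap (U t) (M t) (c t)) z) t₀) =
        Lump.metricC (c t₀) * c' ^ 2 +
          ∑ i, (Lump.metricA i (c t₀) * σ i ^ 2 + Lump.metricD i (c t₀) * η i ^ 2 +
            Lump.metricF i (c t₀) * (σ i * η i))) ∧
    -- the volume of the moduli space is finite
    Lump.lumpVolume < ⊤ := by
  obtain ⟨hmetric, horbit, hvol⟩ := mainTheorem3_general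
  exact ⟨hmetric, fun U M c t₀ c' σ η hUS hMS hc₀ hc₁ => horbit U M c t₀ c' σ η (hUS t₀).1
    (hMS t₀).1 ((pow_eq_one_iff_of_nonneg hc₀ two_ne_zero).not.2 hc₁), hvol⟩
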